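/- Let $\Bbbk$ be a field and let $P$ be a finite partially ordered set with least element $\hat 0$; write $\lambda\lessdot\alpha$ when $\alpha$ covers $\lambda$. Suppose that $P$ is a lattice or a geometric semilattice. (A geometric semilattice is a finite ranked meet semilattice in which every interval is a geometric lattice, and such that, whenever $A$ is a set of atoms with a join of rank $|A|$ and $\operatorname{rank}(x)<\operatorname{rank}(\bigvee A)$, there is $a\in A$ with $a\not\le x$ for which $x\vee a$ exists.) For $\alpha\in P$ let $D_\alpha$ and $\Delta_\alpha$ be the order complexes of $(\hat 0,\alpha]$ and $(\hat 0,\alpha)$. Let $\Sigma_\alpha$ be the full simplex on the set of atoms below or equal to $\alpha$, and let $\Gamma_\alpha$ be the crosscut complex of $(\hat 0,\alpha)$: its faces are the sets of atoms having an upper bound in $(\hat 0,\alpha)$. Then $\Delta_\alpha=\bigcup_{\lambda\lessdot\alpha}D_\lambda$ and $\Gamma_\alpha=\bigcup_{\lambda\lessdot\alpha}\Sigma_\lambda$. The sequence $C_\bullet(P)$ has terms $C_0=\widetilde H_{-1}(\emptyset,\Bbbk)$ and $C_i=\bigoplus_{\alpha\ne\hat 0}C_{i,\alpha}$ with $C_{i,\alpha}=\widetilde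 H_{i-2}(\Delta_\alpha,\Bbbk)$ for $i\ge 1$. Its maps $\varphi_i:C_i\to C_{i-1}$ are as follows. The map $\varphi_1$ is the identity of $\widetilde H_{-1}(\emptyset,\Bbbk)$ on each $C_{1,\alpha}$ with $\alpha$ an atom (the other $C_{1,\alpha}$ vanish). For $i\ge2$ the restriction of $\varphi_i$ to $C_{i,\alpha}$ is the sum over $\lambda\lessdot\alpha$ of the compositions $$\widetilde H_{i-2}(\Delta_\alpha,\Bbbk)\xrightarrow{\ \delta\ }\widetilde H_{i-3}(\Delta_{\alpha,\lambda},\Bbbk)\xrightarrow{\ \iota\ }\widetilde H_{i-3}(\Delta_\lambda,\Bbbk),\qquad \Delta_{\alpha,\lambda}=D_\lambda\cap\bigcup_{\lambda\ne\beta\lessdot\alpha}D_\beta,$$ where $\delta$ is the Mayer–Vietoris connecting homomorphism of the triple $\bigl(D_\lambda,\ \bigcup_{\lambda\ne\beta\lessdot\alpha}D_\beta,\ \Delta_\alpha\bigr)$ and $\iota$ is induced by inclusion. The sequence $C_\bullet(P,\Gamma)$ is built in the same way with $\Gamma_\alpha,\Sigma_\lambda$ in place of $\Delta_\alpha,D_\lambda$.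 Then $C_\bullet(P)$ and $C_\bullet(P,\Gamma)$ are canonically isomorphic: there is a unique family of $\Bbbk$-linear isomorphisms $\Psi_i:C_i(P)\to C_i(P,\Gamma)$, $i\ge 0$, such that $\Psi_i\circ\varphi_{i+1}=\varphi_{i+1}\circ\Psi_{i+1}$ for all $i\ge 0$ and such that, for every function $s$ assigning to each $x\neq\hat 0$ an atom $s(x)\le x$, the map $\Psi_0$ is the identity and, for $i\ge1$, $\Psi_i$ is the direct sum over $\alpha\ne\hat 0$ of the maps $\widetilde H_{i-2}(\Delta_\alpha,\Bbbk)\to\widetilde H_{i-2}(\Gamma_\alpha,\Bbbk)$ induced by the simplicial map $x\mapsto s(x)$. -/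

import Mathlib

namespace PosetSeq

noncomputable section

open scoped DirectSum

set_option linter.unusedSectionVars false

/-! ### Oriented simplicial chains and reduced homology

A (possibly empty) simplicial complex with vertices in `V` is a `PreAbstractSimplicialComplex V`:
a set of nonempty finite faces closed under nonempty subsets.  The empty complex is `⊥`.
The degree of a chain group is recorded by the number `n` of vertices, so that `n`-vertex
chains have dimension `n - 1`, and `n = 0` is the augmentation degree `-1`. -/

section Homology

variable (k : Type*) [Field k] {V : Type*} [Fintype V]

open Classical in
/-- The set of vertices of the tuple `v` is a face of `K`, or is empty. -/
def Supports (K : PreAbstractSimplicialComplex V) {n : ℕ} (v : Fin n → V) : Prop :=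
  Finset.univ.image v = ∅ ∨ Finset.univ.image v ∈ K

/-- The augmented oriented chains of dimension `n - 1`: functions `c` on ordered simplices
`(v₁, …, vₙ)` of `K` which change sign when two vertices are interchanged (and vanish on
degenerate tuples).  The value `c v` is the coefficient of the oriented simplex
`[v₁, …, vₙ]`.  For `n = 0` this is the one-dimensional space `k · [∅]`. -/
def chains (K : PreAbstractSimplicialComplex V) (n : ℕ) : Submodule k ((Fin n → V) → k) where
  carrier := {c | (∀ v i j, i ≠ j → c (v ∘ Equiv.swap i j) = - c v) ∧
    (∀ v, ¬ Function.Injective v → c v = 0) ∧ (∀ v, ¬ Supports K v → c v = 0)}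
  add_mem' := by
    rintro a b ⟨h1, h2, h3⟩ ⟨h1', h2', h3'⟩
    refine ⟨fun v i j h => ?_, fun v h => ?_, fun v h => ?_⟩
    · simp [h1 v i j h, h1' v i j h]; ring
    · simp [h2 v h, h2' v h]
    · simp [h3 v h, h3' v h]
  zero_mem' := by simp
  smul_mem' := by
    rintro r a ⟨h1, h2, h3⟩
    refine ⟨fun v i j h => ?_, fun v h => ?_, fun v h => ?_⟩
    · simp [h1 v i j h]
    · simp [h2 v h]
    · simp [h3 v h]

/-- The usual boundary map `[v₀, …, vₙ] ↦ ∑ (-1)ⁱ [v₀, …, v̂ᵢ, …, vₙ]`, written on coefficient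
functions: the coefficient of `[u]` in `d c` is the sum over all vertices `w` of the coefficient
of `[w, u]` in `c`. -/
def bd (n : ℕ) : ((Fin (n + 1) → V) → k) →ₗ[k] ((Fin n → V) → k) where
  toFun c u := ∑ w : V, c (Fin.cons w u)
  map_add' a b := by ext u; simp [Finset.sum_add_distrib]
  map_smul' r a := by ext u; simp [Finset.mul_sum]

/-- Cycles; in the augmentation degree every chain is a cycle. -/
def cycles (K : PreAbstractSimplicialComplex V) :
    (n : ℕ) → Submodule k ((Fin n → V) → k)
  | 0 => chains k K 0
  | n + 1 => chains k K (n + 1) ⊓ LinearMap.ker (bd k n)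

/-- Boundaries. -/
def boundaries (K : PreAbstractSimplicialComplex V) (n : ℕ) : Submodule k ((Fin n → V) → k) :=
  (chains k K (n + 1)).map (bd k n)

/-- `RedHomology k K n` is the reduced homology `H̃_{n-1}(K, k)`. -/
abbrev RedHomology (K : PreAbstractSimplicialComplex V) (n : ℕ) : Type _ :=
  ↥(cycles k K n) ⧸ (boundaries k K n).submoduleOf (cycles k K n)

variable {k}

open Classical in
/-- The map induced on chains by a vertex map `f`: `[v₁, …, vₙ] ↦ [f v₁, …, f vₙ]` (which is `0`
if the image is degenerate), written on coefficient functions. -/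
def push {W : Type*} (f : V → W) (n : ℕ) : ((Fin n → V) → k) →ₗ[k] ((Fin n → W) → k) where
  toFun c u := ∑ v : Fin n → V, if f ∘ v = u then c v else 0
  map_add' a b := by
    ext u; simp only [Pi.add_apply, ← Finset.sum_add_distrib]
    exact Finset.sum_congr rfl fun v _ => by split_ifs <;> simp
  map_smul' r a := by
    ext u; simp only [Pi.smul_apply, RingHom.id_apply, smul_eq_mul, Finset.mul_sum]
    exact Finset.sum_congr rfl fun v _ => by split_ifs <;> simp

open Classical in
/-- The part of a chain supported on the faces of the subcomplex `A`. -/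
def restr (A : PreAbstractSimplicialComplex V) (n : ℕ) :
    ((Fin n → V) → k) →ₗ[k] ((Fin n → V) → k) where
  toFun c v := if Supports A v then c v else 0
  map_add' a b := by ext v; simp only [Pi.add_apply]; split_ifs <;> simp
  map_smul' r a := by ext v; simp


/-! Helper facts needed for the maps on homology to be well defined. -/

theorem sum_antisymm {g : V → V → k} (h0 : ∀ w, g w w = 0) (h : ∀ w w', g w w' = - g w' w) :
    ∑ w, ∑ w', g w w' = 0 := by
  classical
  rw [← Finset.sum_product' (s := Finset.univ) (t := Finset.univ)]
  refine Finset.sum_involution (fun p _ => p.swap) ?_ ?_ ?_ ?_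
  · rintro ⟨a, b⟩ _; simp [h a b]
  · rintro ⟨a, b⟩ _ hne heq
    simp only [Prod.swap_prod_mk, Prod.mk.injEq] at heq
    obtain ⟨rfl, -⟩ := heq
    exact hne (h0 _)
  · simp
  · simp

theorem Supports.mono {K L : PreAbstractSimplicialComplex V} (h : K ≤ L) {n : ℕ}
    {v : Fin n → V} (hv : Supports K v) : Supports L v :=
  hv.imp id (fun h' => h h')

theorem Supports.comp {K : PreAbstractSimplicialComplex V} {m n : ℕ}
    {v : Fin n → V} (hv : Supports K v) (f : Fin m → Fin n) : Supports K (v ∘ f) := by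
  classical
  have hsub : Finset.univ.image (v ∘ f) ⊆ Finset.univ.image v := by
    intro x; simp only [Finset.mem_image]; rintro ⟨i, -, rfl⟩; exact ⟨f i, Finset.mem_univ _, rfl⟩
  unfold Supports at hv ⊢
  rcases Finset.eq_empty_or_nonempty (Finset.univ.image (v ∘ f)) with h0 | h0
  · left; convert h0
  · right
    rcases hv with hv | hv
    · rw [Finset.eq_empty_iff_forall_notMem] at hv
      obtain ⟨x, hx⟩ := h0
      exact absurd (by convert hsub hx) (hv x)
    · have hmem : Finset.univ.image v ∈ K.faces := by
        change Finset.univ.image v ∈ K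
        convert hv
      have := (K.isRelLowerSet_faces hmem).2 hsub h0
      change Finset.univ.image (v ∘ f) ∈ K at this
      convert this

theorem supports_swap_iff {K : PreAbstractSimplicialComplex V} {n : ℕ}
    {v : Fin n → V} (i j : Fin n) : Supports K (v ∘ Equiv.swap i j) ↔ Supports K v := by
  refine ⟨fun h => ?_, fun h => h.comp _⟩
  have := h.comp (Equiv.swap i j)
  rwa [Function.comp_assoc, show (Equiv.swap i j : Fin n → Fin n) ∘ Equiv.swap i j = id by
    ext; simp, Function.comp_id] at this

theorem chains_mono {K L : PreAbstractSimplicialComplex V} (h : K ≤ L) (n : ℕ) :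
    chains k K n ≤ chains k L n :=
  fun _ hc => ⟨hc.1, hc.2.1, fun v hv => hc.2.2 v fun h' => hv (h'.mono h)⟩

theorem cycles_mono {K L : PreAbstractSimplicialComplex V} (h : K ≤ L) (n : ℕ) :
    cycles k K n ≤ cycles k L n := by
  cases n with
  | zero => exact chains_mono h 0
  | succ n => exact inf_le_inf_right _ (chains_mono h _)

theorem boundaries_mono {K L : PreAbstractSimplicialComplex V} (h : K ≤ L) (n : ℕ) :
    boundaries k K n ≤ boundaries k L n :=
  Submodule.map_mono (chains_mono h _)

theorem bd_mem_chains {K : PreAbstractSimplicialComplex V} {n : ℕ} {c : (Fin (n + 1) → V) → k}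
    (hc : c ∈ chains k K (n + 1)) : bd k n c ∈ chains k K n := by
  obtain ⟨h1, h2, h3⟩ := hc
  refine ⟨fun v i j hij => ?_, fun v hv => ?_, fun v hv => ?_⟩
  · simp only [bd, LinearMap.coe_mk, AddHom.coe_mk, ← Finset.sum_neg_distrib]
    refine Finset.sum_congr rfl fun w _ => ?_
    rw [← h1 _ i.succ j.succ (by simpa using hij)]
    congr 1
    ext x
    refine Fin.cases ?_ (fun y => ?_) x
    · simp [Equiv.swap_apply_of_ne_of_ne (Fin.succ_ne_zero i).symm (Fin.succ_ne_zero j).symm]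
    · simp only [Fin.cons_succ, Function.comp_apply]
      rw [show Equiv.swap i.succ j.succ y.succ = (Equiv.swap i j y).succ from
        (Fin.succ_injective n).swap_apply i j y]
      simp
  · refine Finset.sum_eq_zero fun w _ => h2 _ fun hinj => hv ?_
    have := hinj.comp (Fin.succ_injective n)
    simpa [Function.comp_def] using this
  · refine Finset.sum_eq_zero fun w _ => h3 _ fun hs => hv ?_
    have := hs.comp (Fin.succ)
    simpa [Function.comp_def] using this

theorem bd_bd {K : PreAbstractSimplicialComplex V} {n : ℕ} {c : (Fin (n + 2) → V) → k}
    (hc : c ∈ chains k K (n + 2)) : bd k n (bd k (n + 1) c) = 0 := by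
  ext u
  refine sum_antisymm (g := fun w w' => c (Fin.cons w' (Fin.cons w u : Fin (n + 1) → V)))
    (fun w => hc.2.1 _ fun hinj => ?_) (fun w w' => ?_)
  · have : (0 : Fin (n + 2)) = 1 := hinj (by
      rw [show (1 : Fin (n + 2)) = Fin.succ 0 from rfl, Fin.cons_succ, Fin.cons_zero, Fin.cons_zero])
    simp at this
  · rw [← hc.1 _ 0 1 (by simp)]
    congr 1
    ext x
    refine Fin.cases ?_ (fun y => Fin.cases ?_ (fun z => ?_) y) x
    · rw [Function.comp_apply, Equiv.swap_apply_left]; rfl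
    · rw [Function.comp_apply, show Fin.succ 0 = (1 : Fin (n + 2)) from rfl,
        Equiv.swap_apply_right]; rfl
    · rw [Function.comp_apply, Equiv.swap_apply_of_ne_of_ne (Fin.succ_ne_zero _)
        (show z.succ.succ ≠ (1 : Fin (n + 2)) from
          fun h => Fin.succ_ne_zero z (Fin.succ_injective _ h))]
      rfl

theorem boundaries_le_cycles (K : PreAbstractSimplicialComplex V) (n : ℕ) :
    boundaries k K n ≤ cycles k K n := by
  rintro _ ⟨c, hc, rfl⟩
  cases n with
  | zero => exact bd_mem_chains hc
  | succ n => exact ⟨bd_mem_chains hc, bd_bd hc⟩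

theorem cycles_le_chains (K : PreAbstractSimplicialComplex V) (n : ℕ) :
    cycles k K n ≤ chains k K n := by
  cases n with
  | zero => exact le_rfl
  | succ n => exact inf_le_left

theorem push_bd {W : Type*} [Fintype W] (f : V → W) (n : ℕ) (c : (Fin (n + 1) → V) → k) :
    bd k n (push f (n + 1) c) = push f n (bd k n c) := by
  classical
  ext u
  simp only [bd, push, LinearMap.coe_mk, AddHom.coe_mk]
  rw [Finset.sum_comm]
  rw [← (Fin.consEquiv (fun _ : Fin (n + 1) => V)).sum_comp]
  rw [Fintype.sum_prod_type_right]
  refine Finset.sum_congr rfl fun v _ => ?_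
  rw [show (if f ∘ v = u then ∑ w : V, c (Fin.cons w v) else 0) =
    ∑ w : V, if f ∘ v = u then c (Fin.cons w v) else 0 by split_ifs <;> simp]
  refine Finset.sum_congr rfl fun w _ => ?_
  have key : ∀ x : W, f ∘ (Fin.cons w v : Fin (n + 1) → V) = Fin.cons x u ↔
      f w = x ∧ f ∘ v = u := by
    intro x
    constructor
    · intro h
      exact ⟨by simpa using congrFun h 0, funext fun i => by simpa using congrFun h i.succ⟩
    · rintro ⟨rfl, rfl⟩
      ext i
      refine Fin.cases ?_ (fun j => ?_) i <;> simp
  have e : (Fin.consEquiv fun _ : Fin (n + 1) => V) (w, v) = Fin.cons w v := rfl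
  simp only [e, key]
  by_cases h : f ∘ v = u <;> simp [h]

open Classical in
/-- `f` carries faces of `K` to faces of `L`, i.e. is a simplicial map. -/
def IsSimplicial {W : Type*} (K : PreAbstractSimplicialComplex V)
    (L : PreAbstractSimplicialComplex W) (f : V → W) : Prop :=
  ∀ s ∈ K, s.image f ∈ L

theorem IsSimplicial.supports {W : Type*} [Fintype W] {K : PreAbstractSimplicialComplex V}
    {L : PreAbstractSimplicialComplex W} {f : V → W} (hf : IsSimplicial K L f) {n : ℕ}
    {v : Fin n → V} (hv : Supports K v) : Supports L (f ∘ v) := by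
  classical
  unfold Supports at hv ⊢
  rw [← Finset.image_image]
  refine hv.imp (fun h => ?_) (fun h => ?_)
  · simp [h]
  · have := hf _ h
    convert this

theorem push_mem_chains {W : Type*} [Fintype W] {K : PreAbstractSimplicialComplex V}
    {L : PreAbstractSimplicialComplex W} {f : V → W} (hf : IsSimplicial K L f) {n : ℕ}
    {c : (Fin n → V) → k} (hc : c ∈ chains k K n) : push f n c ∈ chains k L n := by
  classical
  obtain ⟨h1, h2, h3⟩ := hc
  have hsw : ∀ (u : Fin n → W) (v : Fin n → V) (i j : Fin n),
      f ∘ (v ∘ Equiv.swap i j) = u ∘ Equiv.swap i j ↔ f ∘ v = u := by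
    intro u v i j
    rw [← Function.comp_assoc]
    exact (Equiv.swap i j).surjective.injective_comp_right.eq_iff
  refine ⟨fun u i j hij => ?_, fun u hu => ?_, fun u hu => ?_⟩
  · simp only [push, LinearMap.coe_mk, AddHom.coe_mk, ← Finset.sum_neg_distrib]
    rw [← ((Equiv.swap i j).arrowCongr (Equiv.refl V)).sum_comp]
    refine Finset.sum_congr rfl fun v _ => ?_
    have e : ((Equiv.swap i j).arrowCongr (Equiv.refl V)) v = v ∘ Equiv.swap i j := by
      ext; simp
    simp only [e, hsw, h1 v i j hij]
    split_ifs <;> simp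
  · simp only [Function.Injective, not_forall] at hu
    obtain ⟨i, j, huij, hij⟩ := hu
    have hus : u ∘ Equiv.swap i j = u := by
      ext x
      rcases eq_or_ne x i with rfl | hxi
      · simp [huij]
      · rcases eq_or_ne x j with rfl | hxj
        · simp [huij]
        · simp [Equiv.swap_apply_of_ne_of_ne hxi hxj]
    refine Finset.sum_involution (fun v _ => v ∘ Equiv.swap i j) ?_ ?_ ?_ ?_
    · intro v _
      have := hsw u v i j
      rw [hus] at this
      simp only [this, h1 v i j hij]
      split_ifs <;> simp
    · intro v _ hne heq
      apply hne
      rw [h2 v fun hinj => hij (hinj (by simpa using congrFun heq j)), ite_self]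
    · simp
    · intro v _; ext x; simp
  · refine Finset.sum_eq_zero fun v _ => ?_
    split_ifs with h
    · subst h
      exact h3 v fun hv => hu (hf.supports hv)
    · rfl

theorem push_mem_cycles {W : Type*} [Fintype W] {K : PreAbstractSimplicialComplex V}
    {L : PreAbstractSimplicialComplex W} {f : V → W} (hf : IsSimplicial K L f) {n : ℕ}
    {c : (Fin n → V) → k} (hc : c ∈ cycles k K n) : push f n c ∈ cycles k L n := by
  cases n with
  | zero => exact push_mem_chains hf hc
  | succ n =>
    refine ⟨push_mem_chains hf hc.1, ?_⟩
    have : bd k n c = 0 := hc.2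
    change bd k n (push f (n + 1) c) = 0
    rw [push_bd, this, map_zero]

theorem push_mem_boundaries {W : Type*} [Fintype W] {K : PreAbstractSimplicialComplex V}
    {L : PreAbstractSimplicialComplex W} {f : V → W} (hf : IsSimplicial K L f) {n : ℕ}
    {c : (Fin n → V) → k} (hc : c ∈ boundaries k K n) : push f n c ∈ boundaries k L n := by
  obtain ⟨e, he, rfl⟩ := hc
  exact ⟨_, push_mem_chains hf he, push_bd f n e⟩

theorem restr_of_mem {A : PreAbstractSimplicialComplex V} {n : ℕ}
    {c : (Fin n → V) → k} (hc : c ∈ chains k A n) : restr A n c = c := by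
  ext v
  simp only [restr, LinearMap.coe_mk, AddHom.coe_mk]
  split_ifs with h
  · rfl
  · exact (hc.2.2 v h).symm

theorem restr_mem_chains {K : PreAbstractSimplicialComplex V}
    (A : PreAbstractSimplicialComplex V) {n : ℕ}
    {c : (Fin n → V) → k} (hc : c ∈ chains k K n) : restr A n c ∈ chains k A n := by
  obtain ⟨h1, h2, h3⟩ := hc
  refine ⟨fun v i j hij => ?_, fun v hv => ?_, fun v hv => ?_⟩
  · simp only [restr, LinearMap.coe_mk, AddHom.coe_mk, h1 v i j hij]
    by_cases h : Supports A v
    · rw [if_pos h, if_pos ((supports_swap_iff i j).2 h)]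
    · rw [if_neg h, if_neg fun h' => h ((supports_swap_iff i j).1 h'), neg_zero]
  · simp [restr, h2 v hv]
  · simp [restr, hv]

theorem sub_restr_mem_chains {A B : PreAbstractSimplicialComplex V} {n : ℕ}
    {c : (Fin n → V) → k} (hc : c ∈ chains k (A ⊔ B) n) : c - restr A n c ∈ chains k B n := by
  have hm : c - restr A n c ∈ chains k (A ⊔ B) n :=
    sub_mem hc (chains_mono le_sup_left _ (restr_mem_chains A hc))
  refine ⟨hm.1, hm.2.1, fun v hv => ?_⟩
  simp only [restr, LinearMap.coe_mk, AddHom.coe_mk, Pi.sub_apply]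
  split_ifs with h
  · simp
  · rw [sub_zero]
    refine hc.2.2 v fun hs => ?_
    rcases hs with hs | hs | hs
    · exact hv (Or.inl hs)
    · exact h (Or.inr hs)
    · exact hv (Or.inr hs)

theorem chains_inf {A B : PreAbstractSimplicialComplex V} {n : ℕ}
    {c : (Fin n → V) → k} (hA : c ∈ chains k A n) (hB : c ∈ chains k B n) :
    c ∈ chains k (A ⊓ B) n := by
  refine ⟨hA.1, hA.2.1, fun v hv => ?_⟩
  by_cases h : Supports A v
  · refine hB.2.2 v fun h' => hv ?_
    rcases h with h | h
    · exact Or.inl h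
    rcases h' with h' | h'
    · exact Or.inl h'
    exact Or.inr ⟨h, h'⟩
  · exact hA.2.2 v h

/-- Whatever splitting `c = c' + c''` of a cycle of `A ⊔ B` with `c'` in `A` and `c''` in `B` is
chosen, `d c'` is a cycle of `A ⊓ B`. -/
theorem bd_mem_cycles_inf {A B : PreAbstractSimplicialComplex V} {n : ℕ}
    {c c' : (Fin (n + 1) → V) → k} (hc : c ∈ cycles k (A ⊔ B) (n + 1))
    (hA : c' ∈ chains k A (n + 1)) (hB : c - c' ∈ chains k B (n + 1)) :
    bd k n c' ∈ cycles k (A ⊓ B) n := by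
  have h0 : bd k n c = 0 := hc.2
  have hm : bd k n c' ∈ chains k (A ⊓ B) n := by
    refine chains_inf (bd_mem_chains hA) ?_
    have : bd k n c' = - bd k n (c - c') := by rw [map_sub, h0]; simp
    rw [this]
    exact neg_mem (bd_mem_chains hB)
  cases n with
  | zero => exact hm
  | succ n => exact ⟨hm, bd_bd hA⟩

/-- If the cycle `c` is a boundary of `A ⊔ B`, then `d c'` is a boundary of `A ⊓ B`. -/
theorem bd_mem_boundaries_inf {A B : PreAbstractSimplicialComplex V} {n : ℕ}
    {c c' : (Fin (n + 1) → V) → k} (hc : c ∈ boundaries k (A ⊔ B) (n + 1))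
    (hA : c' ∈ chains k A (n + 1)) (hB : c - c' ∈ chains k B (n + 1)) :
    bd k n c' ∈ boundaries k (A ⊓ B) n := by
  obtain ⟨e, he, rfl⟩ := hc
  refine ⟨c' - bd k (n + 1) (restr A (n + 2) e), chains_inf ?_ ?_, ?_⟩
  · exact sub_mem hA (bd_mem_chains (restr_mem_chains A he))
  · have : c' - bd k (n + 1) (restr A (n + 2) e) =
        bd k (n + 1) (e - restr A (n + 2) e) - (bd k (n + 1) e - c') := by
      rw [map_sub]; abel
    rw [this]
    exact sub_mem (bd_mem_chains (sub_restr_mem_chains he)) hB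
  · rw [map_sub, bd_bd (restr_mem_chains A he), sub_zero]

variable (k)

/-- The map `H̃_{n-1}(K) → H̃_{n-1}(L)` induced by a simplicial map. -/
def homMap {W : Type*} [Fintype W] {K : PreAbstractSimplicialComplex V}
    {L : PreAbstractSimplicialComplex W} (f : V → W) (hf : IsSimplicial K L f) (n : ℕ) :
    RedHomology k K n →ₗ[k] RedHomology k L n :=
  Submodule.mapQ _ _ ((push f n).restrict fun _ hc => push_mem_cycles hf hc)
    fun _ hc => push_mem_boundaries hf hc

/-- The map `H̃_{n-1}(K) → H̃_{n-1}(L)` induced by the inclusion of a subcomplex `K ≤ L`. -/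
def homIncl {K L : PreAbstractSimplicialComplex V} (h : K ≤ L) (n : ℕ) :
    RedHomology k K n →ₗ[k] RedHomology k L n :=
  Submodule.mapQ _ _ (Submodule.inclusion (cycles_mono h n))
    fun _ hc => boundaries_mono h n hc

/-- The Mayer–Vietoris connecting homomorphism `H̃_n(A ∪ B) → H̃_{n-1}(A ∩ B)`, `[c] ↦ [d c']`,
where `c'` is the part of `c` supported on `A`, so that `c'' = c - c'` is supported on `B`. -/
def connecting (A B : PreAbstractSimplicialComplex V) (n : ℕ) :
    RedHomology k (A ⊔ B) (n + 1) →ₗ[k] RedHomology k (A ⊓ B) n :=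
  Submodule.mapQ _ _
    ((bd k n ∘ₗ restr A (n + 1)).restrict fun _ hc =>
      bd_mem_cycles_inf hc (restr_mem_chains A (cycles_le_chains _ _ hc))
        (sub_restr_mem_chains (cycles_le_chains _ _ hc)))
    fun c hc => bd_mem_boundaries_inf hc (restr_mem_chains A (cycles_le_chains _ _ c.2))
        (sub_restr_mem_chains (cycles_le_chains _ _ c.2))

/-- The connecting homomorphism may be computed from any splitting `c = c' + c''`. -/
theorem connecting_mk {A B : PreAbstractSimplicialComplex V} {n : ℕ}
    (c : cycles k (A ⊔ B) (n + 1)) {c' : (Fin (n + 1) → V) → k}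
    (hA : c' ∈ chains k A (n + 1)) (hB : c.1 - c' ∈ chains k B (n + 1)) :
    connecting k A B n (Submodule.Quotient.mk c) =
      Submodule.Quotient.mk ⟨bd k n c', bd_mem_cycles_inf c.2 hA hB⟩ := by
  have hc := cycles_le_chains _ _ c.2
  have hr := restr_mem_chains A hc
  refine (Submodule.Quotient.eq _).2 ?_
  refine ⟨restr A (n + 1) c.1 - c', chains_inf (sub_mem hr hA) ?_, map_sub _ _ _⟩
  have : restr A (n + 1) c.1 - c' = (c.1 - c') - (c.1 - restr A (n + 1) c.1) := by abel
  rw [this]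
  exact sub_mem hB (sub_restr_mem_chains hc)

end Homology

/-! ### Lattices and geometric semilattices -/

section Order

variable (P : Type*) [PartialOrder P]

/-- Any two elements have a meet. -/
def HasMeets : Prop := ∀ a b : P, ∃ c, IsGLB {a, b} c

/-- `P` is a lattice: any two elements have a meet and a join. -/
def IsLatticePoset : Prop :=
  (∀ a b : P, ∃ c, IsGLB {a, b} c) ∧ (∀ a b : P, ∃ c, IsLUB {a, b} c)

/-- A (finite) geometric lattice: a lattice in which every element is a join of atoms (elements
covering the bottom element), and which is upper semimodular. -/
structure IsGeometricLattice : Prop where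
  isLattice : IsLatticePoset P
  atomistic : ∀ b : P, ∃ s : Set P, (∀ a ∈ s, ∃ m, IsBot m ∧ m ⋖ a) ∧ IsLUB s b
  semimodular : ∀ a b m j : P, IsGLB {a, b} m → IsLUB {a, b} j → m ⋖ a → b ⋖ j

/-- A (finite) geometric semilattice: a ranked meet semilattice all of whose intervals are
geometric lattices, such that, if `A` is an independent set of atoms
(it has a join `y`, and `rank y = |A|`) and `rank x < rank y`, then there is `a ∈ A`
with `a ≰ x` such that the join of `x` and `a` exists.  The rank of an element of a ranked
poset with least element is its height. -/
structure IsGeometricSemilattice [OrderBot P] : Prop where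
  meets : HasMeets P
  ranked : ∀ a b : P, a ⋖ b → Order.height b = Order.height a + 1
  interval : ∀ x y : P, x ≤ y → IsGeometricLattice (Set.Icc x y)
  exchange : ∀ (A : Finset P) (y : P), (∀ a ∈ A, IsAtom a) → IsLUB (A : Set P) y →
    Order.height y = A.card → ∀ x : P, Order.height x < Order.height y →
      ∃ a ∈ A, ¬ a ≤ x ∧ ∃ z, IsLUB {x, a} z

variable {P}

theorem hasMeets_of_lattice_or_geometric [OrderBot P]
    (h : IsLatticePoset P ∨ IsGeometricSemilattice P) : HasMeets P :=
  h.elim (fun h => h.1) (fun h => h.meets)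

end Order

/-! ### Order complexes and crosscut complexes -/

section Complexes

variable {P : Type*} [PartialOrder P]

/-- The order complex of a subset `Q` of `P`: its nonempty finite chains. -/
def orderComplex (Q : Set P) : PreAbstractSimplicialComplex P where
  faces := {s | s.Nonempty ∧ (s : Set P) ⊆ Q ∧ IsChain (· ≤ ·) (s : Set P)}
  isRelLowerSet_faces := fun {_} hs => ⟨hs.1, fun _ hts ht =>
    ⟨ht, (Finset.coe_subset.2 hts).trans hs.2.1, hs.2.2.mono (Finset.coe_subset.2 hts)⟩⟩

/-- The crosscut complex of a subset `Q` of `P` with respect to the atoms of `P` lying in `Q`: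
the nonempty finite sets of such atoms that have an upper bound in `Q`. -/
def crosscutComplex [OrderBot P] (Q : Set P) : PreAbstractSimplicialComplex P where
  faces := {s | s.Nonempty ∧ (∀ a ∈ s, IsAtom a ∧ a ∈ Q) ∧ ∃ x ∈ Q, ∀ a ∈ s, a ≤ x}
  isRelLowerSet_faces := fun {_} hs => ⟨hs.1, fun _ hts ht =>
    ⟨ht, fun a ha => hs.2.1 a (hts ha), hs.2.2.imp fun _ hx => ⟨hx.1, fun a ha => hx.2 a (hts ha)⟩⟩⟩

theorem mem_iSup_complex {V : Type*} {ι : Sort*} {K : ι → PreAbstractSimplicialComplex V} {s : Finset V} :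
    s ∈ ⨆ i, K i ↔ ∃ i, s ∈ K i := by
  change s ∈ ⋃ L ∈ Set.range K, L.faces ↔ _
  simp only [Set.mem_range, Set.iUnion_exists, Set.iUnion_iUnion_eq', Set.mem_iUnion]
  rfl

/-- A family of complexes from which a sequence of vector spaces is built: `full b` plays the
role of `D_b` (resp. the full simplex on the atoms below `b`), and `part a` that of
`Δ_a` (resp. `Γ_a`). -/
structure Family (P : Type*) [PartialOrder P] where
  full : P → PreAbstractSimplicialComplex P
  part : P → PreAbstractSimplicialComplex P
  part_eq : ∀ a, part a = ⨆ b, ⨆ _ : b ⋖ a, full b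
  inter_le : ∀ a b, b ⋖ a → full b ⊓ (⨆ c, ⨆ _ : c ⋖ a ∧ c ≠ b, full c) ≤ part b

variable [OrderBot P]

/-- `D_b = Δ((0̂, b])` and `Δ_a = Δ((0̂, a))`. -/
def orderFamily (P : Type*) [PartialOrder P] [OrderBot P] [Fintype P] : Family P where
  full b := orderComplex (Set.Ioc ⊥ b)
  part a := orderComplex (Set.Ioo ⊥ a)
  part_eq a := by
    ext s
    change s ∈ orderComplex _ ↔ s ∈ ⨆ b, ⨆ _ : b ⋖ a, orderComplex (Set.Ioc ⊥ b)
    simp only [mem_iSup_complex]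
    constructor
    · rintro ⟨h1, h2, h3⟩
      obtain ⟨m, hm, hmax⟩ := s.exists_maximal h1
      obtain ⟨b, hmb, hb⟩ := exists_le_covBy_of_lt (h2 hm).2
      refine ⟨b, hb, h1, fun x hx => ⟨(h2 hx).1, le_trans ?_ hmb⟩, h3⟩
      rcases h3.total hx hm with h | h
      · exact h
      · exact hmax hx h
    · rintro ⟨b, hb, h1, h2, h3⟩
      exact ⟨h1, fun x hx => ⟨(h2 hx).1, (h2 hx).2.trans_lt hb.lt⟩, h3⟩
  inter_le a b hb := by
    rintro s ⟨⟨h1, h2, h3⟩, hs⟩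
    change s ∈ ⨆ c, ⨆ _ : c ⋖ a ∧ c ≠ b, orderComplex (Set.Ioc ⊥ c) at hs
    simp only [mem_iSup_complex] at hs
    obtain ⟨c, ⟨hc, hcb⟩, -, h2', -⟩ := hs
    refine ⟨h1, fun x hx => ⟨(h2 hx).1, lt_of_le_of_ne (h2 hx).2 ?_⟩, h3⟩
    rintro rfl
    exact (hb.eq_or_eq (h2' hx).2 hc.le).elim hcb hc.ne

/-- The full simplex on the atoms below `b`, and the crosscut complex `Γ_a` of `(0̂, a)`.  The
inclusion of `Γ_{a,b}` into `Γ_b` needed to build the sequence uses the meets of `P`. -/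
def crosscutFamily [Fintype P] (hP : HasMeets P) : Family P where
  full b := crosscutComplex (Set.Ioc ⊥ b)
  part a := crosscutComplex (Set.Ioo ⊥ a)
  part_eq a := by
    ext s
    change s ∈ crosscutComplex _ ↔ s ∈ ⨆ b, ⨆ _ : b ⋖ a, crosscutComplex (Set.Ioc ⊥ b)
    simp only [mem_iSup_complex]
    constructor
    · rintro ⟨h1, h2, x, hx, h3⟩
      obtain ⟨b, hxb, hb⟩ := exists_le_covBy_of_lt hx.2
      exact ⟨b, hb, h1, fun y hy => ⟨(h2 y hy).1, (h2 y hy).2.1, (h3 y hy).trans hxb⟩,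
        x, ⟨hx.1, hxb⟩, h3⟩
    · rintro ⟨b, hb, h1, h2, x, hx, h3⟩
      exact ⟨h1, fun y hy => ⟨(h2 y hy).1, (h2 y hy).2.1, (h2 y hy).2.2.trans_lt hb.lt⟩,
        x, ⟨hx.1, hx.2.trans_lt hb.lt⟩, h3⟩
  inter_le a b hb := by
    rintro s ⟨⟨h1, h2, x, hx, h3⟩, hs⟩
    change s ∈ ⨆ c, ⨆ _ : c ⋖ a ∧ c ≠ b, crosscutComplex (Set.Ioc ⊥ c) at hs
    simp only [mem_iSup_complex] at hs
    obtain ⟨c, ⟨hc, hcb⟩, -, h2', -⟩ := hs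
    obtain ⟨m, hm⟩ := hP b c
    have hmb : m ≤ b := hm.1 (by simp)
    have hmc : m ≤ c := hm.1 (by simp)
    have hlt : m < b := by
      refine lt_of_le_of_ne hmb ?_
      rintro rfl
      exact (hb.eq_or_eq hmc hc.le).elim hcb hc.ne
    have hle : ∀ y ∈ s, y ≤ m := fun y hy => hm.2 (by
      rintro z (rfl | rfl)
      · exact (h2 y hy).2.2
      · exact (h2' y hy).2.2)
    refine ⟨h1, fun y hy => ⟨(h2 y hy).1, (h2 y hy).2.1, (hle y hy).trans_lt hlt⟩,
      m, ⟨?_, hlt⟩, hle⟩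
    obtain ⟨y, hy⟩ := h1
    exact (h2 y hy).2.1.trans_le (hle y hy)

end Complexes

/-! ### The sequences of vector spaces -/

section Sequence

variable (k : Type*) [Field k] {P : Type*} [PartialOrder P] [Fintype P]

/-- The union of the `full c` over all `c ≠ b` covered by `a`. -/
def Family.rest (F : Family P) (a b : P) : PreAbstractSimplicialComplex P :=
  ⨆ c, ⨆ _ : c ⋖ a ∧ c ≠ b, F.full c

theorem Family.part_le (F : Family P) {a b : P} : F.part a ≤ F.full b ⊔ F.rest a b := by
  rw [F.part_eq]
  refine iSup₂_le fun c hc => ?_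
  by_cases h : c = b
  · subst h; exact le_sup_left
  · exact le_sup_of_le_right (le_iSup₂_of_le (f := fun c (_ : c ⋖ a ∧ c ≠ b) => F.full c)
      c ⟨hc, h⟩ le_rfl)

/-- For `b ⋖ a`, the composition
`H̃_n(Δ_a) → H̃_{n-1}(Δ_{a,b}) → H̃_{n-1}(Δ_b)` of the connecting homomorphism of the triple
`(D_b, ⋃_{b ≠ c ⋖ a} D_c, Δ_a)` with the map induced by inclusion, where
`Δ_{a,b} = D_b ∩ ⋃_{b ≠ c ⋖ a} D_c`. -/
def Family.comp (F : Family P) {a b : P} (h : b ⋖ a) (n : ℕ) :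
    RedHomology k (F.part a) (n + 1) →ₗ[k] RedHomology k (F.part b) n :=
  homIncl k (F.inter_le a b h) n ∘ₗ connecting k (F.full b) (F.rest a b) n ∘ₗ
    homIncl k F.part_le (n + 1)

variable [OrderBot P]

/-- The spaces `C_0 = H̃_{-1}(∅, k)` and `C_i = ⨁_{a ≠ 0̂} H̃_{i-2}(Δ_a, k)` for `i ≥ 1`. -/
def term (F : Family P) : ℕ → Type _
  | 0 => RedHomology k (⊥ : PreAbstractSimplicialComplex P) 0
  | n + 1 => ⨁ a : {a : P // a ≠ ⊥}, RedHomology k (F.part a) n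

instance (F : Family P) (i : ℕ) : AddCommMonoid (term k F i) :=
  match i with
  | 0 => inferInstanceAs (AddCommMonoid (RedHomology k (⊥ : PreAbstractSimplicialComplex P) 0))
  | n + 1 => inferInstanceAs
      (AddCommMonoid (⨁ a : {a : P // a ≠ ⊥}, RedHomology k (F.part a) n))

instance (F : Family P) (i : ℕ) : Module k (term k F i) :=
  match i with
  | 0 => inferInstanceAs (Module k (RedHomology k (⊥ : PreAbstractSimplicialComplex P) 0))
  | n + 1 => inferInstanceAs
      (Module k (⨁ a : {a : P // a ≠ ⊥}, RedHomology k (F.part a) n))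

open Classical in
/-- The maps `φ_{i+1} : C_{i+1} → C_i`.  `φ_1` is the identity of `H̃_{-1}(∅, k)` on the summands
with `Δ_a = ∅` (the other summands of `C_1` vanish), and `φ_i` is the sum over all
`b ⋖ a` of the maps above for `i ≥ 2` (only `a` with `Δ_a = ∅` cover `0̂`, and these do not
contribute to `C_i` for `i ≥ 2`). -/
def phi (F : Family P) : (i : ℕ) → term k F (i + 1) →ₗ[k] term k F i
  | 0 => DirectSum.toModule k {a : P // a ≠ ⊥}
      (RedHomology k (⊥ : PreAbstractSimplicialComplex P) 0)
      fun a => if h : F.part a ≤ ⊥ then homIncl k h 0 else 0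
  | n + 1 => DirectSum.toModule k {a : P // a ≠ ⊥}
      (⨁ b : {b : P // b ≠ ⊥}, RedHomology k (F.part b) n)
      fun a => ∑ b : {b : P // b ≠ ⊥},
        if h : b.1 ⋖ a.1 then
          DirectSum.lof k {b : P // b ≠ ⊥} (fun b => RedHomology k (F.part b) n) b ∘ₗ
            F.comp k h n
        else 0

/-- `s` selects, for every element `a ≠ 0̂`, an atom `s a ≤ a` (for instance the least atom below
`a` in a fixed total ordering of the atoms). -/
def IsAtomSelection (s : P → P) : Prop := ∀ a, a ≠ ⊥ → IsAtom (s a) ∧ s a ≤ a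

theorem IsAtomSelection.isSimplicial {s : P → P} (hs : IsAtomSelection s) (hP : HasMeets P)
    (a : P) : IsSimplicial ((orderFamily P).part a) ((crosscutFamily hP).part a) s := by
  classical
  rintro t ⟨h1, h2, h3⟩
  obtain ⟨m, hm, hmax⟩ := t.exists_maximal h1
  refine ⟨h1.image s, fun y hy => ?_, m, h2 hm, fun y hy => ?_⟩
  · obtain ⟨x, hx, rfl⟩ := Finset.mem_image.1 hy
    have h := hs x (h2 hx).1.ne'
    exact ⟨h.1, h.1.bot_lt, h.2.trans_lt (h2 hx).2⟩
  · obtain ⟨x, hx, rfl⟩ := Finset.mem_image.1 hy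
    refine (hs x (h2 hx).1.ne').2.trans ?_
    rcases h3.total hx hm with h | h
    · exact h
    · exact hmax hx h

/-- The map from the sequence of the order complexes to the sequence of the crosscut complexes
determined by an atom selection `s`: the identity of `H̃_{-1}(∅, k)` in degree `0`, and
the direct sum of the maps `H̃_{i-2}(Δ_a) → H̃_{i-2}(Γ_a)` induced by the simplicial maps
`x ↦ s x` in degree `i ≥ 1`. -/
def crosscutMap {s : P → P} (hs : IsAtomSelection s) (hP : HasMeets P) :
    (i : ℕ) → term k (orderFamily P) i →ₗ[k] term k (crosscutFamily hP) i
  | 0 => (LinearMap.id : RedHomology k (⊥ : PreAbstractSimplicialComplex P) 0 →ₗ[k]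
      RedHomology k (⊥ : PreAbstractSimplicialComplex P) 0)
  | n + 1 => DirectSum.lmap fun a : {a : P // a ≠ ⊥} =>
      homMap k s (hs.isSimplicial hP a.1) n

end Sequence

end
end PosetSeq

namespace PosetSeq

noncomputable section

open scoped DirectSum

set_option linter.unusedSectionVars false

/-! ### Acyclicity of cones, by an explicit contracting homotopy on alternating chains -/

section Cone

variable {k : Type*} [Field k] {V : Type*} [Fintype V]

/-! Fix an atom selection `s`. Everything reduces to three facts about the maps `x ↦ s x` on
homology: they are isomorphisms, they do not depend on `s`, and they commute with the `φ_i`.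
Uniqueness is then immediate, since a selection exists and prescribes every `Ψ_i`.

Isomorphism (`IsConeSystem.isQuasiIso`): on lower subsets `Q` of `P ∖ {0̂}`, both the order complex
and the crosscut complex turn unions into unions and intersections into intersections, and both send
`(0̂, x]` to a cone. For the crosscut complex, intersections are handled with meets. Removing a
maximal `x` from `Q` writes `Q` as `(Q ∖ {x}) ∪ (0̂, x]` with intersection `(0̂, x)`, so
Mayer–Vietoris and induction on `|Q|` show that `s` is a quasi-isomorphism. The five lemma is
replaced by a chain-level statement (`IsQuasiIso.sup`): a cycle of the mapping cone is split over
the two pieces and each part is filled.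

Independence (`IsAtomSelection.homMap_eq`): `s` factors through the complex of pairs `(x, a)` with
`a ≤ x` an atom, as the graph `x ↦ (x, s x)` followed by the second projection. The first projection
is a quasi-isomorphism by the same induction, and every graph is a section of it. On homology all
graphs are therefore its inverse.

Compatibility (`Family.comp_homMap`): `s` maps each piece of the Mayer–Vietoris triple for `Δ_a`
into the matching piece for `Γ_a`, and the connecting map can be computed from any splitting of a
cycle. -/

theorem chains_perm {K : PreAbstractSimplicialComplex V} {n : ℕ} {c : (Fin n → V) → k}
    (hc : c ∈ chains k K n) (σ : Equiv.Perm (Fin n)) (v : Fin n → V) :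
    c (v ∘ σ) = ((Equiv.Perm.sign σ : ℤ) : k) * c v := by
  induction σ using Equiv.Perm.swap_induction_on' generalizing v with
  | one => simp
  | mul_swap σ i j hij ih =>
    rw [Equiv.Perm.coe_mul, ← Function.comp_assoc, hc.1 _ i j hij, ih, Equiv.Perm.sign_mul,
      Equiv.Perm.sign_swap hij]
    simp

/-- Makes the choice of permutation in `coneChain` harmless: `σ` and `τ` differ by a permutation
fixing `0`, whose sign appears once in front and once from reordering the tail, and cancels. -/
theorem chains_tail_perm {K : PreAbstractSimplicialComplex V} {n : ℕ} {c : (Fin n → V) → k}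
    (hc : c ∈ chains k K n) {σ τ : Equiv.Perm (Fin (n + 1))} (h : σ 0 = τ 0)
    (v : Fin (n + 1) → V) :
    ((Equiv.Perm.sign σ : ℤ) : k) * c (fun j => v (σ j.succ)) =
      ((Equiv.Perm.sign τ : ℤ) : k) * c (fun j => v (τ j.succ)) := by
  obtain ⟨⟨p, ρ⟩, hρ⟩ := Equiv.Perm.decomposeFin.symm.surjective (τ⁻¹ * σ)
  have hp : p = 0 := by
    have := congrArg (fun π : Equiv.Perm (Fin (n + 1)) => π 0) hρ
    simpa [h] using this
  subst hp
  have hσ : σ = τ * Equiv.Perm.decomposeFin.symm (0, ρ) := by rw [hρ]; group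
  have h1 : (fun j : Fin n => v (σ j.succ)) = (fun j => v (τ j.succ)) ∘ ρ := by
    ext j
    simp [hσ]
  rw [h1, chains_perm hc, hσ, Equiv.Perm.sign_mul, Equiv.Perm.decomposeFin.symm_sign]
  rcases Int.units_eq_one_or (Equiv.Perm.sign ρ) with h2 | h2 <;> simp [h2]

open Classical in
/-- The cone operator `[v₁, …, vₙ] ↦ [p, v₁, …, vₙ]` on coefficient functions. -/
def coneChain (p : V) {n : ℕ} (c : (Fin n → V) → k) (v : Fin (n + 1) → V) : k :=
  if h : Function.Injective v ∧ ∃ σ : Equiv.Perm (Fin (n + 1)), v (σ 0) = p then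
    ((Equiv.Perm.sign h.2.choose : ℤ) : k) * c (fun j => v (h.2.choose j.succ))
  else 0

theorem coneChain_eq {K : PreAbstractSimplicialComplex V} (p : V) {n : ℕ} {c : (Fin n → V) → k}
    (hc : c ∈ chains k K n) {v : Fin (n + 1) → V} (hv : Function.Injective v)
    {σ : Equiv.Perm (Fin (n + 1))} (hσ : v (σ 0) = p) :
    coneChain p c v = ((Equiv.Perm.sign σ : ℤ) : k) * c (fun j => v (σ j.succ)) := by
  have h : Function.Injective v ∧ ∃ σ : Equiv.Perm (Fin (n + 1)), v (σ 0) = p := ⟨hv, σ, hσ⟩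
  rw [coneChain, dif_pos h]
  exact chains_tail_perm hc (hv (h.2.choose_spec.trans hσ.symm)) v

theorem coneChain_of_not_injective (p : V) {n : ℕ} (c : (Fin n → V) → k) {v : Fin (n + 1) → V}
    (hv : ¬ Function.Injective v) : coneChain p c v = 0 :=
  dif_neg fun h => hv h.1

theorem coneChain_of_forall_ne (p : V) {n : ℕ} (c : (Fin n → V) → k) {v : Fin (n + 1) → V}
    (hv : ∀ i, v i ≠ p) : coneChain p c v = 0 :=
  dif_neg fun h => hv _ h.2.choose_spec

theorem coneChain_cons {K : PreAbstractSimplicialComplex V} (p : V) {n : ℕ}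
    {c : (Fin n → V) → k} (hc : c ∈ chains k K n) {u : Fin n → V}
    (hu : ∀ i, u i ≠ p) : coneChain p c (Fin.cons p u : Fin (n + 1) → V) = c u := by
  by_cases h : Function.Injective u
  · rw [coneChain_eq (σ := 1) p hc (Fin.cons_injective_iff.2 ⟨by rintro ⟨i, hi⟩; exact hu i hi, h⟩)
      (by simp)]
    simp
  · rw [coneChain_of_not_injective, hc.2.1 u h]
    exact fun h' => h (Fin.cons_injective_iff.1 h').2

open Classical in
/-- `p` is an apex of `K`: the complex `K` is a cone over the vertex `p`. -/
def IsApex (K : PreAbstractSimplicialComplex V) (p : V) : Prop :=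
  {p} ∈ K ∧ ∀ s ∈ K, insert p s ∈ K

theorem IsApex.supports_of_tail {K : PreAbstractSimplicialComplex V} {p : V} (hp : IsApex K p)
    {n : ℕ} {v : Fin (n + 1) → V} {σ : Equiv.Perm (Fin (n + 1))} (hσ : v (σ 0) = p)
    (h : Supports K fun j : Fin n => v (σ j.succ)) : Supports K v := by
  classical
  have key : Finset.univ.image v =
      insert p (Finset.univ.image fun j : Fin n => v (σ j.succ)) := by
    ext x
    simp only [Finset.mem_image, Finset.mem_univ, true_and, Finset.mem_insert]
    constructor
    · rintro ⟨i, rfl⟩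
      obtain ⟨j, rfl⟩ := σ.surjective i
      refine Fin.cases (Or.inl hσ) (fun j => Or.inr ⟨j, rfl⟩) j
    · rintro (rfl | ⟨j, rfl⟩)
      · exact ⟨_, hσ⟩
      · exact ⟨_, rfl⟩
  right
  have h' : Finset.univ.image v ∈ K := by
    rw [key]
    rcases h with h | h
    · have h : (Finset.univ.image fun j : Fin n => v (σ j.succ)) = ∅ := by convert h
      rw [h]
      exact hp.1
    · convert hp.2 _ h
  convert h'

theorem coneChain_mem_chains {K : PreAbstractSimplicialComplex V} {p : V} (hp : IsApex K p)
    {n : ℕ} {c : (Fin n → V) → k} (hc : c ∈ chains k K n) :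
    coneChain p c ∈ chains k K (n + 1) := by
  refine ⟨fun v i j hij => ?_, fun v hv => coneChain_of_not_injective p c hv, fun v hv => ?_⟩
  · by_cases hv : Function.Injective v
    · by_cases hex : ∃ l, v l = p
      · obtain ⟨l, hl⟩ := hex
        have h1 : v (Equiv.swap 0 l 0) = p := by simpa using hl
        -- This permutation brings `p` to the front of the swapped tuple with the same tail as
        -- before, so the two values differ by the sign of one transposition.
        have h2 : (v ∘ Equiv.swap i j) ((Equiv.swap i j * Equiv.swap 0 l) 0) = p := by
          simpa using hl
        rw [coneChain_eq p hc hv h1,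
          coneChain_eq p hc (hv.comp (Equiv.swap i j).injective) h2, Equiv.Perm.sign_mul,
          Equiv.Perm.sign_swap hij]
        simp [-Equiv.Perm.sign_swap']
      · push Not at hex
        rw [coneChain_of_forall_ne p c hex, coneChain_of_forall_ne p c (v := v ∘ _) fun l => hex _,
          neg_zero]
    · rw [coneChain_of_not_injective p c hv, coneChain_of_not_injective p c, neg_zero]
      intro h
      apply hv
      have := h.comp (Equiv.swap i j).injective
      rwa [Function.comp_assoc, show (Equiv.swap i j : Fin (n + 1) → Fin (n + 1)) ∘
        Equiv.swap i j = id by ext; simp, Function.comp_id] at this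
  · by_cases h : Function.Injective v ∧ ∃ σ : Equiv.Perm (Fin (n + 1)), v (σ 0) = p
    · obtain ⟨h1, σ, hσ⟩ := h
      rw [coneChain_eq p hc h1 hσ, hc.2.2, mul_zero]
      exact fun h' => hv (hp.supports_of_tail hσ h')
    · exact dif_neg h

theorem bd_coneChain_zero {K : PreAbstractSimplicialComplex V} {p : V}
    {c : (Fin 0 → V) → k} (hc : c ∈ chains k K 0) :
    bd k 0 (coneChain p c) = c := by
  ext u
  change ∑ w, coneChain p c (Fin.cons w u : Fin 1 → V) = c u
  rw [Finset.sum_eq_single p]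
  · exact coneChain_cons p hc fun i => i.elim0
  · intro w _ hw
    refine coneChain_of_forall_ne p c fun i => ?_
    refine Fin.cases (by simpa using hw) (fun i => i.elim0) i
  · simp

/-- By alternation a tuple containing `p` can be rearranged to start with `p`, so these two kinds of
tuple determine a chain. -/
theorem chains_ext_of_cons {K L : PreAbstractSimplicialComplex V} {p : V} {n : ℕ}
    {c d : (Fin (n + 1) → V) → k}
    (hc : c ∈ chains k K (n + 1)) (hd : d ∈ chains k L (n + 1))
    (h1 : ∀ u, (∀ i, u i ≠ p) → c u = d u)
    (h2 : ∀ u : Fin n → V, (∀ i, u i ≠ p) → c (Fin.cons p u) = d (Fin.cons p u)) : c = d := by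
  ext u
  by_cases hu : Function.Injective u
  swap
  · rw [hc.2.1 u hu, hd.2.1 u hu]
  by_cases hex : ∃ l, u l = p
  · obtain ⟨l, hl⟩ := hex
    have h0 : (u ∘ Equiv.swap 0 l) 0 = p := by simpa using hl
    have hcons : u ∘ Equiv.swap 0 l = Fin.cons p (Fin.tail (u ∘ Equiv.swap 0 l)) := by
      rw [← h0, Fin.cons_self_tail]
    have hinj := hu.comp (Equiv.swap 0 l).injective
    have h3 := h2 (Fin.tail (u ∘ Equiv.swap 0 l)) fun i hi => by
      exact Fin.succ_ne_zero i (hinj (hi.trans h0.symm))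
    rw [← hcons, chains_perm hc, chains_perm hd] at h3
    refine mul_left_cancel₀ ?_ h3
    rcases Int.units_eq_one_or (Equiv.Perm.sign (Equiv.swap 0 l)) with h | h <;> simp [h]
  · push Not at hex
    exact h1 u hex

/-- The identity `d(p * c) = c - p * dc` for a cycle `c`, checked on tuples that avoid `p` and on
tuples that start with `p`. -/
theorem bd_coneChain_succ {K : PreAbstractSimplicialComplex V} {p : V} (hp : IsApex K p)
    {n : ℕ} {c : (Fin (n + 1) → V) → k} (hc : c ∈ cycles k K (n + 1)) :
    bd k (n + 1) (coneChain p c) = c := by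
  have he := coneChain_mem_chains hp hc.1
  refine chains_ext_of_cons (p := p) (bd_mem_chains he) hc.1 (fun u hu => ?_) (fun u hu => ?_)
  · change ∑ w, coneChain p c (Fin.cons w u : Fin (n + 2) → V) = c u
    rw [Finset.sum_eq_single p]
    · exact coneChain_cons p hc.1 hu
    · intro w _ hw
      refine coneChain_of_forall_ne p c fun i => ?_
      refine Fin.cases (by simpa using hw) (fun i => by simpa using hu i) i
    · simp
  · have hd : ∑ w, c (Fin.cons w u : Fin (n + 1) → V) = 0 := congrFun hc.2 u
    classical
    rw [← Finset.add_sum_erase _ _ (Finset.mem_univ p)] at hd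
    change ∑ w, coneChain p c (Fin.cons w (Fin.cons p u : Fin (n + 1) → V) : Fin (n + 2) → V) = _
    rw [← Finset.add_sum_erase _ _ (Finset.mem_univ p), coneChain_of_not_injective, zero_add,
      eq_neg_of_add_eq_zero_left hd, ← Finset.sum_neg_distrib]
    · refine Finset.sum_congr rfl fun w hw => ?_
      have hw : w ≠ p := by simpa using hw
      have hsw : (Fin.cons w (Fin.cons p u : Fin (n + 1) → V) : Fin (n + 2) → V) =
          (Fin.cons p (Fin.cons w u : Fin (n + 1) → V) : Fin (n + 2) → V) ∘ Equiv.swap 0 1 := by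
        ext x
        refine Fin.cases ?_ (fun y => Fin.cases ?_ (fun z => ?_) y) x
        · rw [Function.comp_apply, Equiv.swap_apply_left]; rfl
        · rw [Function.comp_apply, show Fin.succ 0 = (1 : Fin (n + 2)) from rfl,
            Equiv.swap_apply_right]; rfl
        · rw [Function.comp_apply, Equiv.swap_apply_of_ne_of_ne (Fin.succ_ne_zero _)
            (show z.succ.succ ≠ (1 : Fin (n + 2)) from
              fun h => Fin.succ_ne_zero z (Fin.succ_injective _ h))]
          rfl
      rw [hsw, he.1 _ 0 1 (by simp), coneChain_cons p hc.1]
      intro i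
      refine Fin.cases (by simpa using hw) (fun i => by simpa using hu i) i
    · intro h
      exact (Fin.cons_injective_iff.1 h).1 ⟨0, rfl⟩

/-- A cone has trivial reduced homology. -/
theorem IsApex.cycles_le_boundaries {K : PreAbstractSimplicialComplex V} {p : V}
    (hp : IsApex K p) (n : ℕ) : cycles k K n ≤ boundaries k K n := by
  intro c hc
  refine ⟨coneChain p c, coneChain_mem_chains hp (cycles_le_chains _ _ hc), ?_⟩
  cases n with
  | zero => exact bd_coneChain_zero hc
  | succ n => exact bd_coneChain_succ hp hc

end Cone

/-! ### Quasi-isomorphisms via mapping cones, and the Mayer–Vietoris gluing -/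

section QuasiIso

variable (k : Type*) [Field k] {V W : Type*} [Fintype V] [Fintype W]

/-- The mapping cone of the chain map induced by the simplicial map `f` from `K` to `L` is
acyclic. -/
def IsQuasiIso (f : V → W) (K : PreAbstractSimplicialComplex V)
    (L : PreAbstractSimplicialComplex W) : Prop :=
  ∀ (n : ℕ), ∀ x ∈ cycles k K n, ∀ y ∈ chains k L (n + 1), bd k n y = push f n x →
    ∃ x' ∈ chains k K (n + 1), ∃ y' ∈ chains k L (n + 2),
      bd k n x' = x ∧ bd k (n + 1) y' = push f (n + 1) x' - y

variable {k} {f : V → W} {K : PreAbstractSimplicialComplex V}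
  {L : PreAbstractSimplicialComplex W}

/-- Supplies the bottom degree of the mapping cone, which `IsQuasiIso` leaves out because its `y`
has at least one vertex. -/
theorem push_zero_surjective (f : V → W) (K : PreAbstractSimplicialComplex V)
    (c : (Fin 0 → W) → k) : ∃ x ∈ chains k K 0, push f 0 x = c := by
  refine ⟨fun _ => c Fin.elim0, ⟨fun _ i => i.elim0, fun v hv => ?_, fun v hv => ?_⟩, ?_⟩
  · exact absurd (Function.injective_of_subsingleton v) hv
  · exact absurd (Or.inl (by simp)) hv
  · ext u
    simp [push, Subsingleton.elim (f ∘ (default : Fin 0 → V)) u, Subsingleton.elim u Fin.elim0]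

theorem push_zero_injective (f : V → W) {x x' : (Fin 0 → V) → k}
    (h : push f 0 x = push f 0 x') : x = x' := by
  ext u
  have := congrFun h (f ∘ u)
  simpa [push, Subsingleton.elim u default] using this

/-- Fill `x` by `x'` in the first cone; then `push f (n + 1) x' - y` is a cycle and is filled in the
second. -/
theorem isQuasiIso_of_isApex (hf : IsSimplicial K L f) {p : V} {q : W} (hp : IsApex K p)
    (hq : IsApex L q) : IsQuasiIso k f K L := by
  intro n x hx y hy hxy
  obtain ⟨x', hx', rfl⟩ := hp.cycles_le_boundaries n hx
  obtain ⟨y', hy', h⟩ := hq.cycles_le_boundaries (n + 1)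
    (show push f (n + 1) x' - y ∈ cycles k L (n + 1) from
      ⟨sub_mem (push_mem_chains hf hx') hy, by
        change bd k n _ = 0
        rw [map_sub, push_bd, hxy, sub_self]⟩)
  exact ⟨x', hx', y', hy', rfl, h⟩

/-- Injectivity applies the hypothesis to a cycle `x` whose image bounds `y`; surjectivity applies
it to `x = 0` and a cycle `y`. -/
theorem IsQuasiIso.homMap_bijective (h : IsQuasiIso k f K L) (hf : IsSimplicial K L f) (n : ℕ) :
    Function.Bijective (homMap k f hf n) := by
  constructor
  · rw [injective_iff_map_eq_zero]
    intro z hz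
    obtain ⟨⟨x, hx⟩, rfl⟩ := Submodule.Quotient.mk_surjective _ z
    obtain ⟨y, hy, hyx⟩ := (Submodule.Quotient.mk_eq_zero _).1 hz
    obtain ⟨x', hx', -, -, h1, -⟩ := h n x hx y hy hyx
    exact (Submodule.Quotient.mk_eq_zero _).2 ⟨x', hx', h1⟩
  · intro z
    obtain ⟨⟨y, hy⟩, rfl⟩ := Submodule.Quotient.mk_surjective _ z
    cases n with
    | zero =>
      obtain ⟨x, hx, hxy⟩ := push_zero_surjective f K y
      exact ⟨Submodule.Quotient.mk ⟨x, hx⟩, congrArg Submodule.Quotient.mk (Subtype.ext hxy)⟩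
    | succ n =>
      have hy0 : bd k n y = 0 := hy.2
      obtain ⟨x', hx', y', hy', h1, h2⟩ := h n 0 (zero_mem _) y hy.1 (by rw [hy0, map_zero])
      exact ⟨Submodule.Quotient.mk ⟨x', hx', h1⟩, (Submodule.Quotient.eq _).2 ⟨y', hy', h2⟩⟩

/-- Once a cycle of the mapping cone is split into cycles over the two pieces, the separate fillings
add up. -/
theorem IsQuasiIso.sup_of_split {A B : PreAbstractSimplicialComplex V}
    {A' B' : PreAbstractSimplicialComplex W} (hA : IsQuasiIso k f A A') (hB : IsQuasiIso k f B B')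
    (n : ℕ) {a b : (Fin n → V) → k} {y z : (Fin (n + 1) → W) → k}
    (ha : a ∈ cycles k A n) (hb : b ∈ cycles k B n) (hy : y ∈ chains k A' (n + 1))
    (hz : z ∈ chains k B' (n + 1)) (hya : bd k n y = push f n a) (hzb : bd k n z = push f n b) :
    ∃ x' ∈ chains k (A ⊔ B) (n + 1), ∃ y' ∈ chains k (A' ⊔ B') (n + 2),
      bd k n x' = a + b ∧ bd k (n + 1) y' = push f (n + 1) x' - (y + z) := by
  obtain ⟨x₁, hx₁, y₁, hy₁, h1, h1'⟩ := hA n a ha y hy hya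
  obtain ⟨x₂, hx₂, y₂, hy₂, h2, h2'⟩ := hB n b hb z hz hzb
  refine ⟨x₁ + x₂, add_mem (chains_mono le_sup_left _ hx₁) (chains_mono le_sup_right _ hx₂),
    y₁ + y₂, add_mem (chains_mono le_sup_left _ hy₁) (chains_mono le_sup_right _ hy₂), ?_, ?_⟩
  · rw [map_add, h1, h2]
  · rw [map_add, map_add, h1', h2']
    abel

/-- The Mayer–Vietoris principle for quasi-isomorphisms. -/
theorem IsQuasiIso.sup {A B : PreAbstractSimplicialComplex V}
    {A' B' : PreAbstractSimplicialComplex W} (hfA : IsSimplicial A A' f)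
    (hfB : IsSimplicial B B' f) (hA : IsQuasiIso k f A A') (hB : IsQuasiIso k f B B')
    (hAB : IsQuasiIso k f (A ⊓ B) (A' ⊓ B')) : IsQuasiIso k f (A ⊔ B) (A' ⊔ B') := by
  intro n x hx y hy hxy
  have hx0 := cycles_le_chains _ _ hx
  have hya := restr_mem_chains A' hy
  have hyb := sub_restr_mem_chains hy
  cases n with
  | zero =>
    -- In the augmentation degree every chain is a cycle and `push f 0` is bijective on chains, so
    -- splitting `y` determines the splitting of `x`.
    obtain ⟨a, ha, hay⟩ := push_zero_surjective f A (bd k 0 (restr A' 1 y))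
    obtain ⟨b, hb, hby⟩ := push_zero_surjective f B (bd k 0 (y - restr A' 1 y))
    obtain rfl : x = a + b := push_zero_injective f (by
      rw [map_add, hay, hby, ← map_add, add_sub_cancel, hxy])
    simpa using sup_of_split hA hB 0 ha hb hya hyb hay.symm hby.symm
  | succ m =>
    set a := restr A (m + 1) x
    set ya := restr A' (m + 2) y
    have ha : a ∈ chains k A (m + 1) := restr_mem_chains A hx0
    have hb : x - a ∈ chains k B (m + 1) := sub_restr_mem_chains hx0
    have hw : bd k m a ∈ cycles k (A ⊓ B) m := bd_mem_cycles_inf hx ha hb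
    have hdx : bd k m x = 0 := hx.2
    -- The restrictions `(a, ya)` need not form a cycle of the mapping cone. Their defect is the
    -- pair of `bd k m a` and this chain, a mapping-cone cycle over `A ⊓ B`.
    have hv : push f (m + 1) a - bd k (m + 1) ya ∈ chains k (A' ⊓ B') (m + 1) := by
      refine chains_inf (sub_mem (push_mem_chains hfA ha) (bd_mem_chains hya)) ?_
      have : push f (m + 1) a - bd k (m + 1) ya =
          bd k (m + 1) (y - ya) - push f (m + 1) (x - a) := by
        rw [map_sub, map_sub, hxy]; abel
      rw [this]
      exact sub_mem (bd_mem_chains hyb) (push_mem_chains hfB hb)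
    obtain ⟨w', hw', v', hv', h1, h2⟩ := hAB m _ hw _ hv (by
      rw [map_sub, bd_bd hya, sub_zero, push_bd])
    -- Moving the filling `(w', v')` of the defect from the `A` part to the `B` part turns both into
    -- cycles without changing their sum.
    have := sup_of_split hA hB (m + 1) (a := a - w') (b := (x - a) + w') (y := ya - v')
      (z := (y - ya) + v')
      ⟨sub_mem ha (chains_mono inf_le_left _ hw'), by
        change bd k m _ = 0
        rw [map_sub, h1, sub_self]⟩
      ⟨add_mem hb (chains_mono inf_le_right _ hw'), by
        change bd k m _ = 0
        rw [map_add, map_sub, h1, hdx]; abel⟩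
      (sub_mem hya (chains_mono inf_le_left _ hv'))
      (add_mem hyb (chains_mono inf_le_right _ hv'))
      (by rw [map_sub, map_sub, h2]; abel)
      (by rw [map_add, map_sub, map_add, map_sub, h2, hxy]; abel)
    rwa [show a - w' + (x - a + w') = x by abel, show ya - v' + (y - ya + v') = y by abel] at this

theorem eq_zero_of_mem_chains_bot {n : ℕ} {c : (Fin (n + 1) → V) → k}
    (hc : c ∈ chains k (⊥ : PreAbstractSimplicialComplex V) (n + 1)) : c = 0 := by
  ext v
  refine hc.2.2 v ?_
  rintro (h | h)
  · simp [Finset.univ_eq_empty_iff] at h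
  · exact h

/-- The map from the empty complex to the empty complex is a quasi-isomorphism. -/
theorem isQuasiIso_bot : IsQuasiIso k f ⊥ ⊥ := by
  intro n x hx y hy hxy
  obtain rfl := eq_zero_of_mem_chains_bot hy
  -- The empty complex has nonzero chains in the augmentation degree; there `push f 0 x = 0` and
  -- injectivity are what force `x = 0`.
  have hx0 : x = 0 := by
    cases n with
    | zero => exact push_zero_injective f (by rw [← hxy, map_zero, map_zero])
    | succ n => exact eq_zero_of_mem_chains_bot hx.1
  subst hx0
  exact ⟨0, zero_mem _, 0, zero_mem _, by simp, by simp⟩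

end QuasiIso

/-! ### Cone systems on lower sets: order, crosscut and flag complexes -/

section Systems

variable {P : Type*} [PartialOrder P] [OrderBot P]

/-- `Q` is a lower subset of `P ∖ {0̂}`. -/
def IsPuncturedLower (Q : Set P) : Prop :=
  ⊥ ∉ Q ∧ ∀ x ∈ Q, ∀ y ≤ x, y ≠ ⊥ → y ∈ Q

theorem isPuncturedLower_Ioc (x : P) : IsPuncturedLower (Set.Ioc ⊥ x) :=
  ⟨by simp, fun _ hy _ hz hz0 => ⟨bot_lt_iff_ne_bot.2 hz0, hz.trans hy.2⟩⟩

theorem isPuncturedLower_Ioo (x : P) : IsPuncturedLower (Set.Ioo ⊥ x) :=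
  ⟨by simp, fun _ hy _ hz hz0 => ⟨bot_lt_iff_ne_bot.2 hz0, hz.trans_lt hy.2⟩⟩

theorem IsPuncturedLower.diff_maximal {Q : Set P} (hQ : IsPuncturedLower Q) {x : P}
    (hx : Maximal (· ∈ Q) x) : IsPuncturedLower (Q \ {x}) := by
  refine ⟨fun h => hQ.1 h.1, fun y hy z hz hz0 => ⟨hQ.2 y hy.1 z hz hz0, ?_⟩⟩
  rintro rfl
  exact hy.2 (hx.eq_of_le hy.1 hz).symm

/-- A functorial assignment of complexes to the lower subsets of `P ∖ {0̂}` which preserves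
unions and intersections and takes principal lower sets to cones. -/
structure IsConeSystem {V : Type*} [Fintype V] (F : Set P → PreAbstractSimplicialComplex V) :
    Prop where
  empty : F ∅ = ⊥
  union : ∀ {Q Q'}, IsPuncturedLower Q → IsPuncturedLower Q' → F (Q ∪ Q') = F Q ⊔ F Q'
  inter : ∀ {Q Q'}, IsPuncturedLower Q → IsPuncturedLower Q' → F (Q ∩ Q') = F Q ⊓ F Q'
  apex : ∀ x, x ≠ ⊥ → ∃ p, IsApex (F (Set.Ioc ⊥ x)) p

/-- Induction on the size of `Q`, gluing a principal lower set onto the complement of a maximal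
element. -/
theorem IsConeSystem.isQuasiIso [Finite P] (k : Type*) [Field k] {V W : Type*} [Fintype V]
    [Fintype W] {F : Set P → PreAbstractSimplicialComplex V}
    {G : Set P → PreAbstractSimplicialComplex W} (hF : IsConeSystem F) (hG : IsConeSystem G)
    {f : V → W} (hf : ∀ Q, IsPuncturedLower Q → IsSimplicial (F Q) (G Q) f)
    (Q : Set P) (hQ : IsPuncturedLower Q) : IsQuasiIso k f (F Q) (G Q) := by
  induction h : Q.ncard using Nat.strong_induction_on generalizing Q with
  | _ n ih =>
    subst h
    rcases Q.eq_empty_or_nonempty with rfl | hne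
    · rw [hF.empty, hG.empty]
      exact isQuasiIso_bot
    obtain ⟨x, hx⟩ := Q.toFinite.exists_maximal hne
    have hx0 : x ≠ ⊥ := fun h => hQ.1 (h ▸ hx.1)
    have h1 := hQ.diff_maximal hx
    have h2 := isPuncturedLower_Ioc x
    have hunion : Q = (Q \ {x}) ∪ Set.Ioc ⊥ x := by
      ext y
      constructor
      · intro hy
        by_cases hyx : y = x
        · subst hyx
          exact Or.inr ⟨bot_lt_iff_ne_bot.2 hx0, le_rfl⟩
        · exact Or.inl ⟨hy, hyx⟩
      · rintro (hy | hy)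
        · exact hy.1
        · exact hQ.2 x hx.1 y hy.2 hy.1.ne'
    have hinter : (Q \ {x}) ∩ Set.Ioc ⊥ x = Set.Ioo ⊥ x := by
      ext y
      constructor
      · rintro ⟨hy, hy'⟩
        exact ⟨hy'.1, lt_of_le_of_ne hy'.2 hy.2⟩
      · intro hy
        exact ⟨⟨hQ.2 x hx.1 y hy.2.le hy.1.ne', hy.2.ne⟩, hy.1, hy.2.le⟩
    have hlt : (Q \ {x}).ncard < Q.ncard := Set.ncard_sdiff_singleton_lt_of_mem hx.1
    have hlt' : (Set.Ioo ⊥ x).ncard < Q.ncard := by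
      refine lt_of_le_of_lt (Set.ncard_le_ncard ?_) hlt
      rw [← hinter]
      exact Set.inter_subset_left
    have hA := ih _ hlt _ h1 rfl
    have hAB := ih _ hlt' _ (isPuncturedLower_Ioo x) rfl
    obtain ⟨p, hp⟩ := hF.apex x hx0
    obtain ⟨q, hq⟩ := hG.apex x hx0
    -- The induction hypothesis is not available here, since `(0̂, x]` may be all of `Q`; the cone
    -- property takes its place.
    have hB := isQuasiIso_of_isApex (k := k) (hf _ h2) hp hq
    rw [← hinter, hF.inter h1 h2, hG.inter h1 h2] at hAB
    rw [hunion, hF.union h1 h2, hG.union h1 h2]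
    exact IsQuasiIso.sup (hf _ h1) (hf _ h2) hA hB hAB

theorem exists_greatest_of_isChain {s : Finset P} (hs : s.Nonempty)
    (h : IsChain (· ≤ ·) (s : Set P)) : ∃ m ∈ s, ∀ x ∈ s, x ≤ m := by
  obtain ⟨m, hm, hmax⟩ := s.exists_maximal hs
  refine ⟨m, hm, fun x hx => ?_⟩
  rcases h.total hx hm with h | h
  · exact h
  · exact hmax hx h

/-- A chain in `Q ∪ Q'` lies entirely in whichever set contains its greatest element. The apex over
`(0̂, x]` is `x`. -/
theorem isConeSystem_orderComplex [Fintype P] :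
    IsConeSystem (orderComplex : Set P → PreAbstractSimplicialComplex P) where
  empty := by
    refine le_bot_iff.1 ?_
    rintro s ⟨⟨x, hx⟩, h, -⟩
    exact (h hx).elim
  union {Q Q'} hQ hQ' := by
    refine le_antisymm ?_ (sup_le ?_ ?_)
    · rintro s ⟨h1, h2, h3⟩
      obtain ⟨m, hm, hmax⟩ := exists_greatest_of_isChain h1 h3
      have h0 : ∀ x ∈ s, x ≠ ⊥ := fun x hx h => by
        rcases h2 hx with hx | hx
        · exact hQ.1 (h ▸ hx)
        · exact hQ'.1 (h ▸ hx)
      rcases h2 hm with hmQ | hmQ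
      · exact Or.inl ⟨h1, fun x hx => hQ.2 m hmQ x (hmax x hx) (h0 x hx), h3⟩
      · exact Or.inr ⟨h1, fun x hx => hQ'.2 m hmQ x (hmax x hx) (h0 x hx), h3⟩
    · exact fun s hs => ⟨hs.1, hs.2.1.trans Set.subset_union_left, hs.2.2⟩
    · exact fun s hs => ⟨hs.1, hs.2.1.trans Set.subset_union_right, hs.2.2⟩
  inter _ _ := le_antisymm
    (fun s hs => ⟨⟨hs.1, hs.2.1.trans Set.inter_subset_left, hs.2.2⟩,
      hs.1, hs.2.1.trans Set.inter_subset_right, hs.2.2⟩)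
    (fun s hs => ⟨hs.1.1, Set.subset_inter hs.1.2.1 hs.2.2.1, hs.1.2.2⟩)
  apex x hx := by
    classical
    have hx' : x ∈ Set.Ioc ⊥ x := ⟨bot_lt_iff_ne_bot.2 hx, le_rfl⟩
    refine ⟨x, ⟨Finset.singleton_nonempty x, by simpa using hx', by simp⟩, ?_⟩
    rintro s ⟨h1, h2, h3⟩
    suffices h : insert x s ∈ orderComplex (Set.Ioc ⊥ x) by convert h
    refine ⟨Finset.insert_nonempty x s, ?_, ?_⟩
    · rw [Finset.coe_insert]
      exact Set.insert_subset hx' h2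
    · rw [Finset.coe_insert]
      exact h3.insert fun b hb _ => Or.inr (h2 hb).2

/-- For intersections, upper bounds in `Q` and in `Q'` are replaced by their meet, which lies above
an atom and so is not `0̂`. Any atom below `x` is an apex over `(0̂, x]`. -/
theorem isConeSystem_crosscutComplex [Fintype P] (hP : HasMeets P) :
    IsConeSystem (crosscutComplex : Set P → PreAbstractSimplicialComplex P) where
  empty := by
    refine le_bot_iff.1 ?_
    rintro s ⟨-, -, x, hx, -⟩
    exact hx.elim
  union {Q Q'} hQ hQ' := by
    refine le_antisymm ?_ (sup_le ?_ ?_)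
    · rintro s ⟨h1, h2, x, hx | hx, h3⟩
      · exact Or.inl ⟨h1, fun a ha => ⟨(h2 a ha).1, hQ.2 x hx a (h3 a ha) (h2 a ha).1.1⟩,
          x, hx, h3⟩
      · exact Or.inr ⟨h1, fun a ha => ⟨(h2 a ha).1, hQ'.2 x hx a (h3 a ha) (h2 a ha).1.1⟩,
          x, hx, h3⟩
    · rintro s ⟨h1, h2, x, hx, h3⟩
      exact ⟨h1, fun a ha => ⟨(h2 a ha).1, Or.inl (h2 a ha).2⟩, x, Or.inl hx, h3⟩
    · rintro s ⟨h1, h2, x, hx, h3⟩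
      exact ⟨h1, fun a ha => ⟨(h2 a ha).1, Or.inr (h2 a ha).2⟩, x, Or.inr hx, h3⟩
  inter {Q Q'} hQ hQ' := by
    refine le_antisymm (le_inf ?_ ?_) ?_
    · rintro s ⟨h1, h2, x, hx, h3⟩
      exact ⟨h1, fun a ha => ⟨(h2 a ha).1, (h2 a ha).2.1⟩, x, hx.1, h3⟩
    · rintro s ⟨h1, h2, x, hx, h3⟩
      exact ⟨h1, fun a ha => ⟨(h2 a ha).1, (h2 a ha).2.2⟩, x, hx.2, h3⟩
    · rintro s ⟨⟨h1, h2, x, hx, h3⟩, -, h2', x', hx', h3'⟩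
      obtain ⟨m, hm⟩ := hP x x'
      have hle : ∀ a ∈ s, a ≤ m := fun a ha => hm.2 (by
        rintro z (rfl | rfl)
        · exact h3 a ha
        · exact h3' a ha)
      have hm0 : m ≠ ⊥ := by
        obtain ⟨a, ha⟩ := h1
        exact ((h2 a ha).1.bot_lt.trans_le (hle a ha)).ne'
      exact ⟨h1, fun a ha => ⟨(h2 a ha).1, (h2 a ha).2, (h2' a ha).2⟩, m,
        ⟨hQ.2 x hx m (hm.1 (by simp)) hm0, hQ'.2 x' hx' m (hm.1 (by simp)) hm0⟩, hle⟩
  apex x hx := by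
    classical
    obtain ⟨a, ha, hax⟩ := (eq_bot_or_exists_atom_le x).resolve_left hx
    have hx' : x ∈ Set.Ioc ⊥ x := ⟨bot_lt_iff_ne_bot.2 hx, le_rfl⟩
    refine ⟨a, ⟨Finset.singleton_nonempty a, ?_, x, hx', by simpa using hax⟩, ?_⟩
    · simpa using ⟨ha, ha.bot_lt, hax⟩
    · rintro s ⟨h1, h2, -⟩
      suffices h : insert a s ∈ crosscutComplex (Set.Ioc ⊥ x) by convert h
      have h3 : ∀ b ∈ insert a s, IsAtom b ∧ b ∈ Set.Ioc ⊥ x := by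
        intro b hb
        rcases Finset.mem_insert.1 hb with rfl | hb
        · exact ⟨ha, ha.bot_lt, hax⟩
        · exact h2 b hb
      exact ⟨Finset.insert_nonempty a s, h3, x, hx', fun b hb => (h3 b hb).2.2⟩

/-- The complex of nonempty finite sets of pairs `(x, a)` with `x ∈ Q` and `a ≤ x` an atom, whose
first components form a chain. -/
def flagComplex (Q : Set P) : PreAbstractSimplicialComplex (P × P) where
  faces := {s | s.Nonempty ∧ (∀ p ∈ s, p.1 ∈ Q ∧ IsAtom p.2 ∧ p.2 ≤ p.1) ∧
    ∀ p ∈ s, ∀ q ∈ s, p.1 ≤ q.1 ∨ q.1 ≤ p.1}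
  isRelLowerSet_faces := fun {_} hs => ⟨hs.1, fun _ hts ht =>
    ⟨ht, fun p hp => hs.2.1 p (hts hp), fun p hp q hq => hs.2.2 p (hts hp) q (hts hq)⟩⟩

theorem image_fst_mem_orderComplex [DecidableEq P] {Q : Set P} {s : Finset (P × P)}
    (hs : s ∈ flagComplex Q) : s.image Prod.fst ∈ orderComplex Q := by
  obtain ⟨h1, h2, h3⟩ := hs
  refine ⟨h1.image _, ?_, ?_⟩
  · intro x hx
    obtain ⟨p, hp, rfl⟩ := Finset.mem_image.1 (Finset.mem_coe.1 hx)
    exact (h2 p hp).1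
  · intro x hx y hy _
    obtain ⟨p, hp, rfl⟩ := Finset.mem_image.1 (Finset.mem_coe.1 hx)
    obtain ⟨q, hq, rfl⟩ := Finset.mem_image.1 (Finset.mem_coe.1 hy)
    exact h3 p hp q hq

theorem exists_greatest_fst {Q : Set P} {s : Finset (P × P)} (hs : s ∈ flagComplex Q) :
    ∃ m ∈ Q, ∀ p ∈ s, p.1 ≤ m := by
  classical
  obtain ⟨h1, h2, h3⟩ := image_fst_mem_orderComplex hs
  obtain ⟨m, hm, hmax⟩ := exists_greatest_of_isChain h1 h3
  exact ⟨m, h2 hm, fun p hp => hmax _ (Finset.mem_image_of_mem _ hp)⟩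

theorem insert_mem_flagComplex [DecidableEq (P × P)] {x a : P} (hx : x ≠ ⊥) (ha : IsAtom a)
    (hax : a ≤ x) {s : Finset (P × P)} (hs : s ∈ flagComplex (Set.Ioc ⊥ x)) :
    insert (x, a) s ∈ flagComplex (Set.Ioc ⊥ x) := by
  obtain ⟨h1, h2, h3⟩ := hs
  have h4 : ∀ p ∈ insert (x, a) s, p.1 ∈ Set.Ioc ⊥ x ∧ IsAtom p.2 ∧ p.2 ≤ p.1 := by
    intro p hp
    rcases Finset.mem_insert.1 hp with rfl | hp
    · exact ⟨⟨bot_lt_iff_ne_bot.2 hx, le_rfl⟩, ha, hax⟩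
    · exact h2 p hp
  refine ⟨Finset.insert_nonempty _ s, h4, fun p hp q hq => ?_⟩
  rcases Finset.mem_insert.1 hp with rfl | hp'
  · exact Or.inr (h4 q hq).1.2
  rcases Finset.mem_insert.1 hq with rfl | hq'
  · exact Or.inl (h4 p hp).1.2
  exact h3 p hp' q hq'

/-- The atom components are unconstrained among themselves, so the argument for order complexes
applies to the first components. -/
theorem isConeSystem_flagComplex [Fintype P] :
    IsConeSystem (flagComplex : Set P → PreAbstractSimplicialComplex (P × P)) where
  empty := by
    refine le_bot_iff.1 ?_
    rintro s ⟨⟨x, hx⟩, h, -⟩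
    exact (h x hx).1.elim
  union {Q Q'} hQ hQ' := by
    refine le_antisymm ?_ (sup_le ?_ ?_)
    · intro s hs
      obtain ⟨m, hm, hmax⟩ := exists_greatest_fst hs
      obtain ⟨h1, h2, h3⟩ := hs
      have h0 : ∀ p ∈ s, p.1 ≠ ⊥ := fun p hp =>
        ((h2 p hp).2.1.bot_lt.trans_le (h2 p hp).2.2).ne'
      rcases hm with hm | hm
      · exact Or.inl ⟨h1, fun p hp => ⟨hQ.2 m hm _ (hmax p hp) (h0 p hp), (h2 p hp).2⟩, h3⟩
      · exact Or.inr ⟨h1, fun p hp => ⟨hQ'.2 m hm _ (hmax p hp) (h0 p hp), (h2 p hp).2⟩, h3⟩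
    · exact fun s hs => ⟨hs.1, fun p hp => ⟨Or.inl (hs.2.1 p hp).1, (hs.2.1 p hp).2⟩, hs.2.2⟩
    · exact fun s hs => ⟨hs.1, fun p hp => ⟨Or.inr (hs.2.1 p hp).1, (hs.2.1 p hp).2⟩, hs.2.2⟩
  inter _ _ := le_antisymm
    (fun s hs => ⟨⟨hs.1, fun p hp => ⟨(hs.2.1 p hp).1.1, (hs.2.1 p hp).2⟩, hs.2.2⟩,
      hs.1, fun p hp => ⟨(hs.2.1 p hp).1.2, (hs.2.1 p hp).2⟩, hs.2.2⟩)
    (fun s hs => ⟨hs.1.1, fun p hp => ⟨⟨(hs.1.2.1 p hp).1, (hs.2.2.1 p hp).1⟩,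
      (hs.1.2.1 p hp).2⟩, hs.1.2.2⟩)
  apex x hx := by
    obtain ⟨a, ha, hax⟩ := (eq_bot_or_exists_atom_le x).resolve_left hx
    refine ⟨(x, a), ⟨Finset.singleton_nonempty _, by simp [ha, hax, bot_lt_iff_ne_bot, hx],
      by simp⟩, fun s hs => ?_⟩
    classical
    convert insert_mem_flagComplex hx ha hax hs

theorem isSimplicial_fst (Q : Set P) :
    IsSimplicial (flagComplex Q) (orderComplex Q) Prod.fst := by
  classical
  intro s hs
  convert image_fst_mem_orderComplex hs

/-- The greatest first component bounds all the chosen atoms. -/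
theorem isSimplicial_snd {Q : Set P} (hQ : IsPuncturedLower Q) :
    IsSimplicial (flagComplex Q) (crosscutComplex Q) Prod.snd := by
  classical
  intro s hs
  obtain ⟨m, hm, hmax⟩ := exists_greatest_fst hs
  obtain ⟨h1, h2, h3⟩ := hs
  refine ⟨h1.image _, fun a ha => ?_, m, hm, fun a ha => ?_⟩
  · obtain ⟨p, hp, rfl⟩ := Finset.mem_image.1 ha
    exact ⟨(h2 p hp).2.1, hQ.2 _ (h2 p hp).1 _ (h2 p hp).2.2 (h2 p hp).2.1.1⟩
  · obtain ⟨p, hp, rfl⟩ := Finset.mem_image.1 ha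
    exact (h2 p hp).2.2.trans (hmax p hp)

theorem IsAtomSelection.image_graph_mem_flagComplex [DecidableEq (P × P)] {s : P → P}
    (hs : IsAtomSelection s) {Q : Set P} (hQ : IsPuncturedLower Q) {t : Finset P}
    (ht : t ∈ orderComplex Q) : t.image (fun x => (x, s x)) ∈ flagComplex Q := by
  obtain ⟨h1, h2, h3⟩ := ht
  refine ⟨h1.image _, fun p hp => ?_, fun p hp q hq => ?_⟩
  · obtain ⟨x, hx, rfl⟩ := Finset.mem_image.1 hp
    exact ⟨h2 hx, hs x fun h => hQ.1 (h ▸ h2 hx)⟩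
  · obtain ⟨x, hx, rfl⟩ := Finset.mem_image.1 hp
    obtain ⟨y, hy, rfl⟩ := Finset.mem_image.1 hq
    exact h3.total hx hy

theorem IsAtomSelection.isSimplicial_graph {s : P → P} (hs : IsAtomSelection s) {Q : Set P}
    (hQ : IsPuncturedLower Q) :
    IsSimplicial (orderComplex Q) (flagComplex Q) fun x => (x, s x) := by
  classical
  intro t ht
  convert hs.image_graph_mem_flagComplex hQ ht

theorem IsSimplicial.comp {U V W : Type*} {K : PreAbstractSimplicialComplex U}
    {L : PreAbstractSimplicialComplex V} {M : PreAbstractSimplicialComplex W} {f : U → V}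
    {g : V → W} (hg : IsSimplicial L M g) (hf : IsSimplicial K L f) :
    IsSimplicial K M (g ∘ f) := by
  classical
  intro s hs
  have := hg _ (hf s hs)
  rw [Finset.image_image] at this
  convert this

theorem IsAtomSelection.isSimplicial_of_lower {s : P → P} (hs : IsAtomSelection s) {Q : Set P}
    (hQ : IsPuncturedLower Q) : IsSimplicial (orderComplex Q) (crosscutComplex Q) s :=
  (isSimplicial_snd hQ).comp (hs.isSimplicial_graph hQ)

end Systems

/-! ### Functoriality of the induced maps -/

section Functoriality

variable {k : Type*} [Field k] {U V W : Type*} [Fintype U] [Fintype V] [Fintype W]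

theorem push_comp (g : V → W) (f : U → V) (n : ℕ) (c : (Fin n → U) → k) :
    push (g ∘ f) n c = push g n (push f n c) := by
  classical
  ext w
  simp only [push, LinearMap.coe_mk, AddHom.coe_mk]
  have : ∀ v : Fin n → V, (if g ∘ v = w then ∑ u, if f ∘ u = v then c u else 0 else 0) =
      ∑ u : Fin n → U, if f ∘ u = v then (if g ∘ v = w then c u else 0) else 0 := by
    intro v
    split_ifs <;> simp
  simp only [this]
  rw [Finset.sum_comm]
  refine Finset.sum_congr rfl fun u _ => ?_
  rw [Finset.sum_ite_eq Finset.univ (f ∘ u), if_pos (Finset.mem_univ _)]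
  rfl

theorem homMap_comp {K : PreAbstractSimplicialComplex U} {L : PreAbstractSimplicialComplex V}
    {M : PreAbstractSimplicialComplex W} {g : V → W} {f : U → V} (hg : IsSimplicial L M g)
    (hf : IsSimplicial K L f) (hgf : IsSimplicial K M (g ∘ f)) (n : ℕ)
    (z : RedHomology k K n) :
    homMap k (g ∘ f) hgf n z = homMap k g hg n (homMap k f hf n z) := by
  obtain ⟨x, rfl⟩ := Submodule.Quotient.mk_surjective _ z
  exact congrArg Submodule.Quotient.mk (Subtype.ext (push_comp g f n x.1))

end Functoriality

/-! ### The isomorphism on homology and its independence of the atom selection -/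

section Crosscut

variable (k : Type*) [Field k] {P : Type*} [PartialOrder P] [OrderBot P] [Fintype P]

theorem IsAtomSelection.homMap_bijective {s : P → P} (hs : IsAtomSelection s) (hP : HasMeets P)
    (a : P) (n : ℕ) : Function.Bijective (homMap k s (hs.isSimplicial hP a) n) :=
  IsQuasiIso.homMap_bijective
    (isConeSystem_orderComplex.isQuasiIso k (isConeSystem_crosscutComplex hP)
      (fun _ hQ => hs.isSimplicial_of_lower hQ) _ (isPuncturedLower_Ioo a)) _ n

/-- The graphs of `s` and `t` are both sections of the first projection, which is injective on
homology; hence they induce the same map, and so do their composites with the second projection. -/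
theorem IsAtomSelection.homMap_eq {s t : P → P} (hs : IsAtomSelection s) (ht : IsAtomSelection t)
    (hP : HasMeets P) (a : P) (n : ℕ) :
    homMap k s (hs.isSimplicial hP a) n = homMap k t (ht.isSimplicial hP a) n := by
  have hQ := isPuncturedLower_Ioo a
  have hinj : Function.Injective (homMap k Prod.fst (isSimplicial_fst (Set.Ioo ⊥ a)) n) :=
    (IsQuasiIso.homMap_bijective (isConeSystem_flagComplex.isQuasiIso k
      isConeSystem_orderComplex (fun Q _ => isSimplicial_fst Q) _ hQ) _ n).1
  have hid : IsSimplicial (orderComplex (Set.Ioo ⊥ a)) (orderComplex (Set.Ioo ⊥ a)) id := by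
    classical
    intro u hu
    simpa using hu
  refine LinearMap.ext fun (z : RedHomology k (orderComplex (Set.Ioo ⊥ a)) n) => ?_
  have hgraph : homMap k _ (hs.isSimplicial_graph hQ) n z =
      homMap k _ (ht.isSimplicial_graph hQ) n z := by
    apply hinj
    exact (homMap_comp (isSimplicial_fst _) (hs.isSimplicial_graph hQ) hid n z).symm.trans
      (homMap_comp (isSimplicial_fst _) (ht.isSimplicial_graph hQ) hid n z)
  exact (homMap_comp (isSimplicial_snd hQ) (hs.isSimplicial_graph hQ) _ n z).trans
    ((congrArg _ hgraph).trans
      (homMap_comp (isSimplicial_snd hQ) (ht.isSimplicial_graph hQ) _ n z).symm)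

end Crosscut

/-! ### Compatibility with the maps of the two sequences -/

section Naturality

variable {k : Type*} [Field k] {P : Type*} [PartialOrder P] [OrderBot P] [Fintype P]

theorem isSimplicial_iSup {V W ι : Type*} {K : ι → PreAbstractSimplicialComplex V}
    {L : ι → PreAbstractSimplicialComplex W} {p : ι → Prop} {f : V → W}
    (h : ∀ i, p i → IsSimplicial (K i) (L i) f) :
    IsSimplicial (⨆ i, ⨆ _ : p i, K i) (⨆ i, ⨆ _ : p i, L i) f := by
  intro s hs
  simp only [mem_iSup_complex] at hs ⊢
  obtain ⟨i, hi, hs⟩ := hs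
  exact ⟨i, hi, h i hi s hs⟩

/-- A vertex map which is simplicial on the full parts and on the unions of the full parts
commutes with the maps from which the sequences are built. -/
theorem Family.comp_homMap {F G : Family P} {f : P → P}
    (hfull : ∀ b, IsSimplicial (F.full b) (G.full b) f)
    (hpart : ∀ a, IsSimplicial (F.part a) (G.part a) f) {a b : P} (h : b ⋖ a) (n : ℕ)
    (z : RedHomology k (F.part a) (n + 1)) :
    homMap k f (hpart b) n (F.comp k h n z) =
      G.comp k h n (homMap k f (hpart a) (n + 1) z) := by
  obtain ⟨⟨c, hc⟩, rfl⟩ := Submodule.Quotient.mk_surjective _ z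
  have hrest : IsSimplicial (F.rest a b) (G.rest a b) f := isSimplicial_iSup fun i _ => hfull i
  have hc' : c ∈ chains k (F.full b ⊔ F.rest a b) (n + 1) := chains_mono F.part_le _ hc.1
  -- The pushed splitting of `c` need not be the restriction of `push f (n + 1) c` to `G.full b`,
  -- but the connecting map accepts any splitting.
  have key := connecting_mk k (A := G.full b) (B := G.rest a b)
    ⟨push f (n + 1) c, cycles_mono G.part_le _ (push_mem_cycles (hpart a) hc)⟩
    (push_mem_chains (hfull b) (restr_mem_chains (F.full b) hc'))
    (by
      rw [← map_sub]
      exact push_mem_chains hrest (sub_restr_mem_chains hc'))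
  refine Eq.trans ?_ (congrArg (homIncl k (G.inter_le a b h) n) key).symm
  exact congrArg Submodule.Quotient.mk
    (Subtype.ext (push_bd f n (restr (F.full b) (n + 1) c)).symm)

theorem push_zero_self (f : P → P) (c : (Fin 0 → P) → k) : push f 0 c = c := by
  classical
  ext u
  simp [push, Subsingleton.elim u default, Subsingleton.elim (f ∘ default) default]

/-- Every element of `(0̂, a)` has an atom below it, again in `(0̂, a)`. This makes the case
distinctions defining `φ_1` agree on both sides. -/
theorem orderFamily_part_le_bot_iff (hP : HasMeets P) (a : P) :
    (orderFamily P).part a ≤ ⊥ ↔ (crosscutFamily hP).part a ≤ ⊥ := by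
  classical
  constructor
  · rintro h s ⟨-, -, x, hx, -⟩
    exact (h (show ({x} : Finset P) ∈ orderComplex (Set.Ioo ⊥ a) from
      ⟨Finset.singleton_nonempty x, by simpa using hx, by simp⟩)).elim
  · rintro h s ⟨⟨x, hx⟩, h2, -⟩
    obtain ⟨y, hy, hyx⟩ := (eq_bot_or_exists_atom_le x).resolve_left (h2 hx).1.ne'
    have hya : y ∈ Set.Ioo ⊥ a := ⟨hy.bot_lt, hyx.trans_lt (h2 hx).2⟩
    exact (h (show ({y} : Finset P) ∈ crosscutComplex (Set.Ioo ⊥ a) from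
      ⟨Finset.singleton_nonempty y, by simpa using ⟨hy, hya⟩, y, hya, by simp⟩)).elim

open Classical in
variable (k) in
/-- The inclusion of the summand indexed by `a` into the `(n + 1)`-st term of the sequence. -/
def Family.summand (F : Family P) (n : ℕ) (a : {a : P // a ≠ ⊥}) :
    RedHomology k (F.part a.1) n →ₗ[k] term k F (n + 1) :=
  DirectSum.lof k {a : P // a ≠ ⊥} (fun a => RedHomology k (F.part a.1) n) a

open Classical in
-- `term` is a direct sum only after unfolding at a successor degree; this and the `summand`
-- formulas below let later proofs work one summand at a time.
theorem Family.term_hom_ext {F : Family P} {n : ℕ} {M : Type*} [AddCommMonoid M] [Module k M]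
    {g h : term k F (n + 1) →ₗ[k] M} (H : ∀ a z, g (F.summand k n a z) = h (F.summand k n a z)) :
    g = h :=
  DirectSum.linearMap_ext k
    (M := fun a : {a : P // a ≠ ⊥} => RedHomology k (F.part a.1) n)
    (ψ := g) (ψ' := h) fun a => LinearMap.ext fun z => H a z

open Classical in
theorem phi_zero_summand (F : Family P) (a : {a : P // a ≠ ⊥}) (z : RedHomology k (F.part a.1) 0) :
    phi k F 0 (F.summand k 0 a z) =
      (if h : F.part a.1 ≤ ⊥ then homIncl k h 0 else 0 :
        RedHomology k (F.part a.1) 0 →ₗ[k] RedHomology k (⊥ : PreAbstractSimplicialComplex P) 0)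
        z :=
  DirectSum.toModule_lof (M := fun a : {a : P // a ≠ ⊥} => RedHomology k (F.part a.1) 0)
    (N := RedHomology k (⊥ : PreAbstractSimplicialComplex P) 0) k a z

open Classical in
theorem phi_succ_summand (F : Family P) (n : ℕ) (a : {a : P // a ≠ ⊥})
    (z : RedHomology k (F.part a.1) (n + 1)) :
    phi k F (n + 1) (F.summand k (n + 1) a z) =
      ∑ b : {b : P // b ≠ ⊥},
        if h : b.1 ⋖ a.1 then F.summand k n b (F.comp k h n z) else 0 := by
  refine (DirectSum.toModule_lof
    (M := fun a : {a : P // a ≠ ⊥} => RedHomology k (F.part a.1) (n + 1))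
    (N := ⨁ b : {b : P // b ≠ ⊥}, RedHomology k (F.part b.1) n) k a z).trans ?_
  refine (LinearMap.sum_apply _ _ _).trans (Finset.sum_congr rfl fun b _ => ?_)
  split_ifs <;> rfl

theorem crosscutMap_summand {s : P → P} (hs : IsAtomSelection s) (hP : HasMeets P) (n : ℕ)
    (a : {a : P // a ≠ ⊥}) (z : RedHomology k ((orderFamily P).part a.1) n) :
    crosscutMap k hs hP (n + 1) ((orderFamily P).summand k n a z) =
      (crosscutFamily hP).summand k n a (homMap k s (hs.isSimplicial hP a.1) n z) := by
  classical
  exact DirectSum.lmap_lof (fun a : {a : P // a ≠ ⊥} => homMap k s (hs.isSimplicial hP a.1) n) a z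

theorem crosscutMap_comp_phi {s : P → P} (hs : IsAtomSelection s) (hP : HasMeets P) (i : ℕ) :
    crosscutMap k hs hP i ∘ₗ phi k (orderFamily P) i =
      phi k (crosscutFamily hP) i ∘ₗ crosscutMap k hs hP (i + 1) := by
  refine Family.term_hom_ext fun a z => ?_
  rw [LinearMap.comp_apply, LinearMap.comp_apply, crosscutMap_summand]
  cases i with
  | zero =>
    rw [phi_zero_summand, phi_zero_summand]
    by_cases h : (orderFamily P).part a.1 ≤ ⊥
    · rw [dif_pos h, dif_pos ((orderFamily_part_le_bot_iff hP _).1 h)]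
      obtain ⟨x, rfl⟩ := Submodule.Quotient.mk_surjective _ z
      exact congrArg Submodule.Quotient.mk (Subtype.ext (push_zero_self s x.1).symm)
    · rw [dif_neg h, dif_neg fun h' => h ((orderFamily_part_le_bot_iff hP _).2 h')]
      rfl
  | succ n =>
    rw [phi_succ_summand, phi_succ_summand, map_sum]
    refine Finset.sum_congr rfl fun b _ => ?_
    by_cases h : b.1 ⋖ a.1
    · rw [dif_pos h, dif_pos h, crosscutMap_summand, Family.comp_homMap
        (fun b => hs.isSimplicial_of_lower (isPuncturedLower_Ioc b))
        (fun a => hs.isSimplicial hP a)]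
    · rw [dif_neg h, dif_neg h, map_zero]

theorem crosscutMap_bijective {s : P → P} (hs : IsAtomSelection s) (hP : HasMeets P) (i : ℕ) :
    Function.Bijective (crosscutMap k hs hP i) := by
  cases i with
  | zero => exact Function.bijective_id
  | succ n =>
    exact ⟨(DirectSum.lmap_injective _).2 fun a => (hs.homMap_bijective k hP a.1 n).1,
      (DirectSum.lmap_surjective _).2 fun a => (hs.homMap_bijective k hP a.1 n).2⟩

theorem crosscutMap_eq {s t : P → P} (hs : IsAtomSelection s) (ht : IsAtomSelection t)
    (hP : HasMeets P) (i : ℕ) : crosscutMap k hs hP i = crosscutMap k ht hP i := by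
  cases i with
  | zero => rfl
  | succ n =>
    simp only [crosscutMap]
    congr 1
    funext a
    exact hs.homMap_eq k ht hP a.1 n

variable (P) in
theorem exists_isAtomSelection : ∃ s : P → P, IsAtomSelection s := by
  have h : ∀ x : P, ∃ a, x ≠ ⊥ → IsAtom a ∧ a ≤ x := fun x => by
    rcases eq_bot_or_exists_atom_le x with h | ⟨a, ha⟩
    -- The value at `0̂` is arbitrary.
    · exact ⟨⊥, fun h' => (h' h).elim⟩
    · exact ⟨a, fun _ => ha⟩
  choose s hs using h
  exact ⟨s, hs⟩

end Naturality

end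
end PosetSeq

theorem mainTheorem2 {k : Type*} [Field k] {P : Type*} [PartialOrder P] [OrderBot P] [Fintype P]
    (hP : PosetSeq.IsLatticePoset P ∨ PosetSeq.IsGeometricSemilattice P) :
    ∃! Ψ : (i : ℕ) →
        PosetSeq.term k (PosetSeq.orderFamily P) i ≃ₗ[k]
          PosetSeq.term k
            (PosetSeq.crosscutFamily (PosetSeq.hasMeets_of_lattice_or_geometric hP)) i,
      (∀ i : ℕ,
        (Ψ i).toLinearMap ∘ₗ PosetSeq.phi k (PosetSeq.orderFamily P) i =
          PosetSeq.phi k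
            (PosetSeq.crosscutFamily (PosetSeq.hasMeets_of_lattice_or_geometric hP)) i ∘ₗ
            (Ψ (i + 1)).toLinearMap) ∧
      ∀ (s : P → P) (hs : PosetSeq.IsAtomSelection s) (i : ℕ),
        (Ψ i).toLinearMap =
          PosetSeq.crosscutMap k hs (PosetSeq.hasMeets_of_lattice_or_geometric hP) i := by
  have hM := PosetSeq.hasMeets_of_lattice_or_geometric hP
  obtain ⟨s, hs⟩ := PosetSeq.exists_isAtomSelection P
  refine ⟨fun i => LinearEquiv.ofBijective (PosetSeq.crosscutMap k hs hM i)
    (PosetSeq.crosscutMap_bijective hs hM i), ⟨fun i => ?_, fun t ht i => ?_⟩, fun Ψ hΨ => ?_⟩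
  · exact PosetSeq.crosscutMap_comp_phi hs hM i
  · exact PosetSeq.crosscutMap_eq hs ht hM i
  -- The formula for a single selection already determines every `Ψ i`.
  · funext i
    exact LinearEquiv.toLinearMap_injective (hΨ.2 s hs i)
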